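/- **Setting.** Let $D$ be the Hamilton quaternion algebra over $\mathbb{Q}$ (ramified exactly at $2$ and $\infty$), $\mathcal{O}_D$ its maximal order $\mathbb{Z}+\mathbb{Z}\mathbf i+\mathbb{Z}\mathbf j+\mathbb{Z}\tfrac{1+\mathbf i+\mathbf j+\mathbf k}{2}$, and $D_f^\times=(D\otimes\mathbb{A}_f)^\times$. Let $\nu\in\mathbb{Z}_5$ be the square root of $-1$ with $\nu\equiv 2 \pmod 5$, and identify $D\otimes\mathbb{Q}_5$ with $\mathrm{M}_2(\mathbb{Q}_5)$ by $\mathbf i\mapsto\begin{pmatrix}0&1\\-1&0\end{pmatrix}$, $\mathbf j\mapsto\begin{pmatrix}\nu&0\\0&-\nu\end{pmatrix}$, $\mathbf k\mapsto\begin{pmatrix}0&-\nu\\-\nu&0\end{pmatrix}$. Let $\widehat{\mathrm{GL}}_2(\mathbb{Z}_5)=\mathrm{GL}_2(\mathbb{Z}_5)\times\prod_{\ell\ne5}(\mathcal{O}_D\otimes\mathbb{Z}_\ell)^\times$ and let $\widehat\Gamma_1(5)$ be its subgroup of elements $u$ whose $5$-component $u_5$ lies in $\begin{pmatrix}\mathbb{Z}_5^\times&\mathbb{Z}_5\\5\mathbb{Z}_5&1+5\mathbb{Z}_5\end{pmatrix}$.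 For $\gamma=\begin{pmatrix}\alpha&\beta\\ \gamma'&\delta\end{pmatrix}$ put $(f\|_k\gamma)(z)=(\gamma' z+\delta)^{k-2}f\big(\tfrac{\alpha z+\beta}{\gamma' z+\delta}\big)$. *Overconvergent forms.* Let $S_k^{D,\dagger}(\widehat\Gamma_1(5))$ be the space of functions $\varphi:D^\times\backslash D_f^\times\to\mathbb{Q}_5\langle z\rangle$ with $\varphi(gu)=\varphi(g)\|_k u_5$ for all $u\in\widehat\Gamma_1(5)$. On it, $U_5(\varphi)(g)=\sum_{i=0}^4\varphi(gv_i^{-1})\|_k v_i$, where $v_i=\begin{pmatrix}5&0\\5i&1\end{pmatrix}$ is placed at $5$. Identifying $\varphi$ with $\varphi(1)\in\mathbb{Q}_5\langle z\rangle$, let $P=(P_{i,j})_{i,j\ge0}$ be the matrix of $U_5$ with respect to $1,z,z^2,\dots$: if $\varphi(1)=z^j$, then $U_5(\varphi)(1)=\sum_i P_{i,j}z^i$. Put $P_n(k,a)=(P_{4i+a,\,4j+a})_{0\le i,j\le n-1}$. *Classical forms.* For $K=\widehat{\mathrm{GL}}_2(\mathbb{Z}_5)$ or $\widehat\Gamma_1(5)$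 let $S_k^D(K)$ be the space of functions $\varphi:D^\times\backslash D_f^\times\to\mathbb{Q}_5[z]^{\deg\le k-2}$ with $\varphi(gu)=\varphi(g)\|_k u_5$ for all $u\in K$. Let $\pi_2$ be a uniformizer of $D\otimes\mathbb{Q}_2$ with $\pi_2^2=2$, let $U_2(\varphi)(g)=\varphi(g\pi_2)$, and let $S^D_{k,a}(K)$ be the eigenspace of $U_2$ on $S_k^D(K)$ with eigenvalue $\big(\tfrac{1+\nu}{2}\big)^{k-2}(-\nu)^a$. Put $d^{\mathrm{unr}}_{k,a}=\dim_{\mathbb{Q}_5} S^D_{k,a}(\widehat{\mathrm{GL}}_2(\mathbb{Z}_5))$ and $d^{\mathrm{Iw}}_{k,a}=\dim_{\mathbb{Q}_5} S^D_{k,a}(\widehat\Gamma_1(5))$. **Theorem.** Let $k_0\ge0$ be an integer and let $k=4k_0+2$ if $a\in\{0,2\}$, $k=4k_0$ if $a\in\{1,3\}$. Then the matrix $P$ is well defined (it exists and is unique), and for every $n$ with $d^{\mathrm{unr}}_{k,a}<n<d^{\mathrm{Iw}}_{k,a}-d^{\mathrm{unr}}_{k,a}$ the corank of the $n\times n$ matrix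 $P_n(k,a)$ is at least $$\min\{\,n-d^{\mathrm{unr}}_{k,a},\ d^{\mathrm{Iw}}_{k,a}-d^{\mathrm{unr}}_{k,a}-n\,\}.$$ -/

import Mathlib

open Filter Topology Polynomial
open scoped Quaternion RestrictedProduct

namespace HeckeFive

instance factPrimes (p : Nat.Primes) : Fact (p : ℕ).Prime := ⟨p.2⟩

instance factPrimeFive : Fact (Nat.Prime 5) := ⟨by norm_num⟩

/-- The prime `2`. -/
abbrev two : Nat.Primes := ⟨2, Nat.prime_two⟩

/-- The prime `5`. -/
abbrev five : Nat.Primes := ⟨5, by norm_num⟩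

/-! ### The quaternion algebra `D = ℍ[ℚ]`, its completions, and the Hurwitz order

`D` is the Hamilton quaternion algebra over `ℚ`, which is ramified exactly at `2` and `∞`, and
`D ⊗ ℚ_p` is `ℍ[ℚ_[p]]`. -/

/-- The quaternion `a + b i + c j + d k`. -/
def quat {R : Type} [CommRing R] (a b c d : R) : ℍ[R] := ⟨a, b, c, d⟩

section

variable {R : Type} [CommRing R] (a b c d : R)

@[simp] theorem quat_re : (quat a b c d).re = a := rfl

@[simp] theorem quat_imI : (quat a b c d).imI = b := rfl

@[simp] theorem quat_imJ : (quat a b c d).imJ = c := rfl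

@[simp] theorem quat_imK : (quat a b c d).imK = d := rfl

end

/-- The completion at `p` of the maximal order `ℤ + ℤ i + ℤ j + ℤ (1 + i + j + k) / 2` of `D`:
the elements `a + b i + c j + d (1 + i + j + k) / 2` with `a, b, c, d ∈ ℤ_p`. -/
noncomputable def hurwitz (p : Nat.Primes) : Subring ℍ[ℚ_[(p : ℕ)]] where
  carrier := {x | ∃ a b c d : ℤ_[(p : ℕ)],
    x = quat ((a : ℚ_[(p : ℕ)]) + d / 2) ((b : ℚ_[(p : ℕ)]) + d / 2)
      ((c : ℚ_[(p : ℕ)]) + d / 2) ((d : ℚ_[(p : ℕ)]) / 2)}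
  zero_mem' := ⟨0, 0, 0, 0, by ext <;> simp⟩
  one_mem' := ⟨1, 0, 0, 0, by ext <;> simp⟩
  add_mem' := by
    rintro _ _ ⟨a, b, c, d, rfl⟩ ⟨a', b', c', d', rfl⟩
    exact ⟨a + a', b + b', c + c', d + d', by ext <;> simp <;> ring⟩
  neg_mem' := by
    rintro _ ⟨a, b, c, d, rfl⟩
    exact ⟨-a, -b, -c, -d, by ext <;> simp <;> ring⟩
  mul_mem' := by
    rintro _ _ ⟨a, b, c, d, rfl⟩ ⟨a', b', c', d', rfl⟩
    refine ⟨a * a' - b * b' - c * c' - d * d' - b * d' - d * c' - b * c' + c * b',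
      a * b' + b * a' + d * b' + c * d' - d * c' - b * c' + c * b',
      a * c' + c * a' - b * d' + c * d' + d * b' - b * c' + c * b',
      a * d' + d * a' + d * d' + b * c' + b * c' + b * d' + d * c' - c * b' - c * b' - c * d' - d * b',
      ?_⟩
    ext <;> simp <;> ring

/-- The compact open subgroup of units of the maximal order of `D ⊗ ℚ_p`. For `p = 2` it is the
maximal compact subgroup of `(D ⊗ ℚ_2)ˣ`; for odd `p` it is `GL₂(ℤ_p)`, for an isomorphism
`D ⊗ ℚ_p ≅ M₂(ℚ_p)` that carries the maximal order to `M₂(ℤ_p)`. -/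
noncomputable abbrev localUnits (p : Nat.Primes) : Subgroup (ℍ[ℚ_[(p : ℕ)]])ˣ :=
  (hurwitz p).toSubmonoid.units

/-- The group `D_fˣ = (D ⊗ 𝔸_f)ˣ`, as the restricted product of the groups `(D ⊗ ℚ_p)ˣ` with
respect to the unit groups of the local maximal orders. -/
abbrev AdelicUnits : Type := Πʳ p : Nat.Primes, [(ℍ[ℚ_[(p : ℕ)]])ˣ, localUnits p]

/-- The inclusion of `D` in `D ⊗ ℚ_p`. -/
noncomputable def localMap (p : Nat.Primes) : ℍ[ℚ] →+* ℍ[ℚ_[(p : ℕ)]] where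
  toFun x := quat (x.re : ℚ_[(p : ℕ)]) (x.imI : ℚ_[(p : ℕ)]) (x.imJ : ℚ_[(p : ℕ)])
    (x.imK : ℚ_[(p : ℕ)])
  map_zero' := by ext <;> simp
  map_one' := by ext <;> simp
  map_add' x y := by ext <;> simp
  map_mul' x y := by ext <;> simp

theorem localMap_apply (p : Nat.Primes) (x : ℍ[ℚ]) :
    localMap p x = quat (x.re : ℚ_[(p : ℕ)]) (x.imI : ℚ_[(p : ℕ)]) (x.imJ : ℚ_[(p : ℕ)])
      (x.imK : ℚ_[(p : ℕ)]) := rfl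

theorem eventually_localMap_mem (x : ℍ[ℚ]) : ∀ᶠ p in cofinite, localMap p x ∈ hurwitz p := by
  have key : ∀ q : ℚ, ∀ᶠ p : Nat.Primes in cofinite, ‖(q : ℚ_[(p : ℕ)])‖ ≤ 1 := by
    intro q
    have hfin : {p : Nat.Primes | (p : ℕ) ∣ q.den}.Finite := by
      refine Set.Finite.of_finite_image (f := fun p : Nat.Primes => (p : ℕ)) ?_
        (Subtype.val_injective.injOn)
      refine (Set.finite_Iic q.den).subset ?_
      rintro _ ⟨p, hp, rfl⟩
      exact Nat.le_of_dvd q.den_pos hp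
    filter_upwards [hfin.compl_mem_cofinite] with p hp
    exact Padic.norm_rat_le_one hp
  filter_upwards [key (x.re - x.imK), key (x.imI - x.imK), key (x.imJ - x.imK),
    key (2 * x.imK)] with p h₁ h₂ h₃ h₄
  refine ⟨⟨_, h₁⟩, ⟨_, h₂⟩, ⟨_, h₃⟩, ⟨_, h₄⟩, ?_⟩
  rw [localMap_apply]
  ext <;> simp

/-- The diagonal embedding of `Dˣ` in `D_fˣ`. -/
noncomputable def diag : (ℍ[ℚ])ˣ →* AdelicUnits where
  toFun δ := RestrictedProduct.mk (fun p => Units.map (localMap p).toMonoidHom δ) (by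
    filter_upwards [eventually_localMap_mem (δ : ℍ[ℚ]),
      eventually_localMap_mem ((δ⁻¹ : (ℍ[ℚ])ˣ) : ℍ[ℚ])] with p h₁ h₂
    exact ⟨h₁, h₂⟩)
  map_one' := by ext p : 1; simp
  map_mul' δ ε := by ext p : 1; simp

/-! ### The splitting at `5` -/

theorem exists_nu : ∃ ν : ℤ_[5], ν * ν = -1 ∧ (5 : ℤ_[5]) ∣ ν - 2 := by
  obtain ⟨z, hz, hz', -⟩ := hensels_lemma (p := 5) (R := ℤ_[5])
    (F := (X ^ 2 + 1 : ℤ_[5][X])) (a := 2) (by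
      have h5 : (2 : ℤ_[5]) ^ 2 + 1 = (5 : ℕ) := by norm_num
      have h4 : ‖((4 : ℤ) : ℤ_[5])‖ = 1 := by
        rw [← PadicInt.isUnit_iff, PadicInt.isUnit_iff]
        by_contra h
        have := lt_of_le_of_ne (PadicInt.norm_le_one ((4 : ℤ) : ℤ_[5])) h
        rw [PadicInt.norm_int_lt_one_iff_dvd] at this
        revert this; decide
      have h4' : (2 : ℤ_[5]) * 2 = ((4 : ℤ) : ℤ_[5]) := by norm_num
      have e1 : (aeval (2 : ℤ_[5])) (X ^ 2 + 1 : ℤ_[5][X]) = (5 : ℕ) := by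
        rw [← h5]; simp
      have e2 : (aeval (2 : ℤ_[5])) (derivative (X ^ 2 + 1 : ℤ_[5][X])) = ((4 : ℤ) : ℤ_[5]) := by
        rw [← h4']; simp [one_add_one_eq_two]
      rw [e1, e2, h4, PadicInt.norm_p]
      norm_num)
  refine ⟨z, ?_, ?_⟩
  · have : z ^ 2 + 1 = 0 := by simpa using hz
    linear_combination this
  · have hlt : ‖z - 2‖ < 1 := lt_of_lt_of_le hz' (PadicInt.norm_le_one _)
    simpa using (PadicInt.norm_lt_one_iff_dvd _).mp hlt

/-- The square root of `-1` in `ℤ_5` that is congruent to `2` modulo `5`. -/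
noncomputable def nu : ℤ_[5] := exists_nu.choose

theorem nu_mul_nu : nu * nu = -1 := exists_nu.choose_spec.1

theorem five_dvd_nu_sub_two : (5 : ℤ_[5]) ∣ nu - 2 := exists_nu.choose_spec.2

/-- `nu` as an element of `ℚ_5`. -/
noncomputable abbrev nuQ : ℚ_[5] := (nu : ℚ_[5])

theorem nuQ_mul_nuQ : nuQ * nuQ = -1 := by
  have := congrArg (fun x : ℤ_[5] => (x : ℚ_[5])) nu_mul_nu
  simpa using this

/-- The isomorphism `D ⊗ ℚ_5 ≅ M₂(ℚ_5)` with `i ↦ (0 1; -1 0)`, `j ↦ (ν 0; 0 -ν)` and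
`k ↦ (0 -ν; -ν 0)`. -/
noncomputable def split : ℍ[ℚ_[5]] ≃+* Matrix (Fin 2) (Fin 2) ℚ_[5] where
  toFun x := !![x.re + x.imJ * nuQ, x.imI - x.imK * nuQ; -x.imI - x.imK * nuQ, x.re - x.imJ * nuQ]
  invFun γ := quat ((γ 0 0 + γ 1 1) / 2) ((γ 0 1 - γ 1 0) / 2) (-(nuQ * (γ 0 0 - γ 1 1)) / 2)
    (nuQ * (γ 0 1 + γ 1 0) / 2)
  left_inv x := by
    have h := nuQ_mul_nuQ
    ext <;> simp
    · linear_combination (-x.imJ) * h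
    · linear_combination (-x.imK) * h
  right_inv γ := by
    have h := nuQ_mul_nuQ
    ext i j
    fin_cases i <;> fin_cases j <;> simp
    · linear_combination (-(γ 0 0 - γ 1 1) / 2) * h
    · linear_combination (-(γ 0 1 + γ 1 0) / 2) * h
    · linear_combination (-(γ 0 1 + γ 1 0) / 2) * h
    · linear_combination ((γ 0 0 - γ 1 1) / 2) * h
  map_add' x y := by
    ext i j
    fin_cases i <;> fin_cases j <;> simp <;> ring
  map_mul' x y := by
    have h := nuQ_mul_nuQ
    ext i j
    fin_cases i <;> fin_cases j <;> simp [Matrix.mul_apply, Fin.sum_univ_two]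
    · linear_combination (-x.imJ * y.imJ - x.imK * y.imK) * h
    · linear_combination (x.imJ * y.imK - x.imK * y.imJ) * h
    · linear_combination (x.imK * y.imJ - x.imJ * y.imK) * h
    · linear_combination (-x.imJ * y.imJ - x.imK * y.imK) * h

/-! ### Level structure -/

/-- `u` lies in the compact open subgroup of `D_fˣ` with component the units of the maximal order
at every `p ≠ 5` and `K ⊆ M₂(ℤ_5)` at `5`, and `γ ∈ K` is its component at `5`. -/
def InLevel (K : Set (Matrix (Fin 2) (Fin 2) ℤ_[5])) (u : AdelicUnits)
    (γ : Matrix (Fin 2) (Fin 2) ℤ_[5]) : Prop :=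
  (∀ p : Nat.Primes, p ≠ five → u p ∈ localUnits p) ∧ γ ∈ K ∧
    split (u five : ℍ[ℚ_[5]]) = γ.map (fun x : ℤ_[5] => (x : ℚ_[5]))

/-- `Iw_{5,1}`: the matrices in `(ℤ_5ˣ, ℤ_5; 5 ℤ_5, 1 + 5 ℤ_5)`. -/
def Iw : Set (Matrix (Fin 2) (Fin 2) ℤ_[5]) :=
  {γ | IsUnit (γ 0 0) ∧ (5 : ℤ_[5]) ∣ γ 1 0 ∧ (5 : ℤ_[5]) ∣ γ 1 1 - 1}

/-- `GL₂(ℤ_5)`. -/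
def GL2Z5 : Set (Matrix (Fin 2) (Fin 2) ℤ_[5]) := {γ | IsUnit γ.det}

/-! ### Overconvergent automorphic forms and `U₅` -/

/-- `c` is the coefficient sequence of an element of the Tate algebra `ℚ_5⟨z⟩` (so it tends to
`0`), and `f` is the function on `ℤ_5` given by that power series. -/
def IsTateExpansion (c : ℕ → ℚ_[5]) (f : ℤ_[5] → ℚ_[5]) : Prop :=
  Tendsto c atTop (𝓝 0) ∧ ∀ z : ℤ_[5], HasSum (fun n => c n * (z : ℚ_[5]) ^ n) (f z)

/-- The Tate algebra `ℚ_5⟨z⟩`. A power series with coefficients tending to `0` is determined by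
its values on `ℤ_5`, and is identified here with the function on `ℤ_5` that it defines. -/
def tate : Set (ℤ_[5] → ℚ_[5]) := {f | ∃ c, IsTateExpansion c f}

/-- `(f ||_k γ)(z) = (c z + d)^(k - 2) f((a z + b) / (c z + d))` for `γ = (a b; c d)` with
`c ∈ 5 ℤ_5` and `d ∈ ℤ_5ˣ` (so that `c z + d` is a unit of `ℤ_5`). -/
noncomputable def slash (k : ℤ) (γ : Matrix (Fin 2) (Fin 2) ℤ_[5]) (f : ℤ_[5] → ℚ_[5]) :
    ℤ_[5] → ℚ_[5] := fun z =>
  ((γ 1 0 * z + γ 1 1 : ℤ_[5]) : ℚ_[5]) ^ (k - 2) *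
    f ((γ 0 0 * z + γ 0 1) * PadicInt.inv (γ 1 0 * z + γ 1 1))

/-- The space of overconvergent automorphic forms of weight `k` and level `Γ̂₁(5)`. -/
def overconvergentForms (k : ℤ) : Set (AdelicUnits → ℤ_[5] → ℚ_[5]) :=
  {φ | (∀ g, φ g ∈ tate) ∧ (∀ (δ : (ℍ[ℚ])ˣ) (g : AdelicUnits), φ (diag δ * g) = φ g) ∧
    ∀ g u γ, InLevel Iw u γ → φ (g * u) = slash k γ (φ g)}

/-- The matrix `v_i = (5 0; 5i 1)`. -/
noncomputable def v (i : ℕ) : Matrix (Fin 2) (Fin 2) ℤ_[5] := !![5, 0; 5 * (i : ℤ_[5]), 1]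

theorem isUnit_v (i : ℕ) : IsUnit ((v i).map (fun x : ℤ_[5] => (x : ℚ_[5]))) := by
  rw [Matrix.isUnit_iff_isUnit_det]
  simp [v, Matrix.det_fin_two]

/-- The element of `D_fˣ` with component `v_i` at `5` and `1` elsewhere. -/
noncomputable def vAdele (i : ℕ) : AdelicUnits :=
  RestrictedProduct.mulSingle localUnits five
    (Units.map (split.symm : Matrix (Fin 2) (Fin 2) ℚ_[5] ≃+* ℍ[ℚ_[5]]).toMonoidHom
      (isUnit_v i).unit)

/-- The operator `U₅`: `U₅(φ)(g) = ∑_{i = 0}^{4} φ(g v_i⁻¹) ||_k v_i`. -/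
noncomputable def U5 (k : ℤ) (φ : AdelicUnits → ℤ_[5] → ℚ_[5]) : AdelicUnits → ℤ_[5] → ℚ_[5] :=
  fun g => ∑ i ∈ Finset.range 5, slash k (v i) (φ (g * (vAdele i)⁻¹))

/-- `P` is the infinite matrix of `U₅` with respect to the power basis `1, z, z², …` of `ℚ_5⟨z⟩`,
when overconvergent forms `φ` are identified with their values `φ(1)`: the `j`-th column holds the
coefficients of `U₅(φ)(1)` for the form `φ` with `φ(1) = z^j`. -/
def IsU5Matrix (k : ℤ) (P : ℕ → ℕ → ℚ_[5]) : Prop :=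
  ∀ φ ∈ overconvergentForms k, ∀ j : ℕ, φ 1 = (fun z : ℤ_[5] => (z : ℚ_[5]) ^ j) →
    IsTateExpansion (fun i => P i j) (U5 k φ 1)

/-- The upper left `n × n` block `(P_{4i+a, 4j+a})_{0 ≤ i, j ≤ n - 1}`. -/
def minor (P : ℕ → ℕ → ℚ_[5]) (a n : ℕ) : Matrix (Fin n) (Fin n) ℚ_[5] :=
  Matrix.of fun i j => P (4 * (i : ℕ) + a) (4 * (j : ℕ) + a)

/-- The corank of an `n × n` matrix, i.e. the dimension of its kernel. -/
noncomputable def corank {n : ℕ} (M : Matrix (Fin n) (Fin n) ℚ_[5]) : ℕ :=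
  Module.finrank ℚ_[5] (LinearMap.ker M.mulVecLin)

/-! ### Classical automorphic forms and their dimensions -/

/-- The right action of `γ = (a b; c d)` on polynomials of degree at most `k - 2`:
`f ↦ (c z + d)^(k - 2) f((a z + b) / (c z + d)) = ∑ f_i (a z + b)^i (c z + d)^(k - 2 - i)`. -/
noncomputable def polySlash (k : ℕ) (γ : Matrix (Fin 2) (Fin 2) ℤ_[5]) :
    ℚ_[5][X] →ₗ[ℚ_[5]] ℚ_[5][X] :=
  ∑ i ∈ Finset.range (k - 1), (LinearMap.toSpanSingleton ℚ_[5] ℚ_[5][X]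
    ((C (γ 0 0 : ℚ_[5]) * X + C (γ 0 1 : ℚ_[5])) ^ i *
      (C (γ 1 0 : ℚ_[5]) * X + C (γ 1 1 : ℚ_[5])) ^ (k - 2 - i))).comp (lcoeff ℚ_[5] i)

/-- The classical automorphic forms of weight `k` whose level is `K ⊆ GL₂(ℤ_5)` at `5` and the
units of the maximal order elsewhere, with values in the polynomials of degree at most `k - 2`
(that is, of degree less than `k - 1`). -/
noncomputable def classicalForms (k : ℕ) (K : Set (Matrix (Fin 2) (Fin 2) ℤ_[5])) :
    Submodule ℚ_[5] (AdelicUnits → ℚ_[5][X]) where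
  carrier := {φ | (∀ g, φ g ∈ degreeLT ℚ_[5] (k - 1)) ∧
    (∀ (δ : (ℍ[ℚ])ˣ) (g : AdelicUnits), φ (diag δ * g) = φ g) ∧
    ∀ g u γ, InLevel K u γ → φ (g * u) = polySlash k γ (φ g)}
  zero_mem' := ⟨fun _ => Submodule.zero_mem _, fun _ _ => rfl, fun _ _ _ _ => by simp⟩
  add_mem' := by
    rintro φ ψ ⟨h₁, h₂, h₃⟩ ⟨h₁', h₂', h₃'⟩
    exact ⟨fun g => Submodule.add_mem _ (h₁ g) (h₁' g), fun δ g => by simp [h₂, h₂'],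
      fun g u γ h => by simp [h₃ g u γ h, h₃' g u γ h]⟩
  smul_mem' := by
    rintro c φ ⟨h₁, h₂, h₃⟩
    exact ⟨fun g => Submodule.smul_mem _ c (h₁ g), fun δ g => by simp [h₂],
      fun g u γ h => by simp [h₃ g u γ h]⟩

theorem exists_root_two : ∃ y : ℤ_[2], y * y + y + 2 = 0 := by
  obtain ⟨z, hz, -⟩ := hensels_lemma (p := 2) (R := ℤ_[2])
    (F := (X ^ 2 + X + C 2 : ℤ_[2][X])) (a := 0) (by
      have h2 : (2 : ℤ_[2]) = (2 : ℕ) := by norm_num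
      simp
      rw [h2, PadicInt.norm_p]
      norm_num)
  refine ⟨z, ?_⟩
  have : z ^ 2 + z + 2 = 0 := by simpa using hz
  linear_combination this

/-- A root `y ∈ ℤ_2` of `y² + y + 2`. -/
noncomputable def y2 : ℚ_[2] := (exists_root_two.choose : ℚ_[2])

theorem y2_spec : y2 * y2 + y2 + 2 = 0 := by
  have := congrArg (fun x : ℤ_[2] => (x : ℚ_[2])) exists_root_two.choose_spec
  have h2 : (((2 : ℕ) : ℤ_[2]) : ℚ_[2]) = 2 := by rw [PadicInt.coe_natCast]; norm_num
  simp only [PadicInt.coe_add, PadicInt.coe_mul, PadicInt.coe_zero] at this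
  rw [← h2]
  exact this

/-- A uniformizer `π₂` of `D ⊗ ℚ_2` with `π₂² = 2` and `π₂ a = Fr₂(a) π₂` for `a` in the unramified
quadratic extension `ℚ_4 = ℚ_2(ζ)`, where `ζ = (-1 + i + j + k) / 2` (see `pi2_mul_pi2`,
`zeta_relation` and `pi2_mul_zeta`). -/
noncomputable def pi2 : ℍ[ℚ_[2]] := quat 0 1 y2 (-(1 + y2))

/-- The primitive cube root of unity `ζ = (-1 + i + j + k) / 2`. -/
noncomputable def zeta : ℍ[ℚ_[2]] := quat (-(1 / 2)) (1 / 2) (1 / 2) (1 / 2)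

theorem zeta_relation : zeta * zeta + zeta + 1 = 0 := by
  ext <;> simp [zeta] <;> norm_num

theorem pi2_mul_pi2 : pi2 * pi2 = 2 := by
  have h := y2_spec
  have h2 : (2 : ℍ[ℚ_[2]]) = ((2 : ℚ_[2]) : ℍ[ℚ_[2]]) := by norm_cast
  rw [h2]
  ext <;> simp [pi2]
  · linear_combination (-2) * h
  all_goals ring

theorem pi2_mul_zeta : pi2 * zeta = zeta * zeta * pi2 := by
  ext <;> simp [zeta, pi2] <;> ring

/-- `π₂` as a unit of `D ⊗ ℚ_2`. -/
noncomputable def pi2Unit : (ℍ[ℚ_[2]])ˣ where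
  val := pi2
  inv := quat 0 (1 / 2) (y2 / 2) (-(1 + y2) / 2)
  val_inv := by
    have h := y2_spec
    ext <;> simp [pi2]
    · linear_combination (-1) * h
    all_goals ring
  inv_val := by
    have h := y2_spec
    ext <;> simp [pi2]
    · linear_combination (-1) * h
    all_goals ring

/-- The element of `D_fˣ` with component `π₂` at `2` and `1` elsewhere. -/
noncomputable def pi2Adele : AdelicUnits :=
  RestrictedProduct.mulSingle localUnits two pi2Unit

/-- The operator `U₂`: `U₂(φ)(g) = φ(g π₂)`. -/
noncomputable def U2 : (AdelicUnits → ℚ_[5][X]) →ₗ[ℚ_[5]] (AdelicUnits → ℚ_[5][X]) :=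
  LinearMap.funLeft ℚ_[5] ℚ_[5][X] (fun g => g * pi2Adele)

/-- The part of `classicalForms k K` on which `U₂` acts as `((1 + ν)/2)^(k - 2) (-ν)^a`. -/
noncomputable def classicalFormsPart (k a : ℕ) (K : Set (Matrix (Fin 2) (Fin 2) ℤ_[5])) :
    Submodule ℚ_[5] (AdelicUnits → ℚ_[5][X]) :=
  classicalForms k K ⊓
    Module.End.eigenspace U2 (((1 + nuQ) / 2) ^ ((k : ℤ) - 2) * (-nuQ) ^ a)

/-- `d^unr_{k,a}`, the dimension of the `a`-part at the level `GL₂(ℤ_5)`. -/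
noncomputable def dUnr (k a : ℕ) : ℕ := Module.finrank ℚ_[5] (classicalFormsPart k a GL2Z5)

/-- `d^Iw_{k,a}`, the dimension of the `a`-part at the level `Γ̂₁(5)`. -/
noncomputable def dIw (k a : ℕ) : ℕ := Module.finrank ℚ_[5] (classicalFormsPart k a Iw)

end HeckeFive

namespace HeckeFive

/-! ### The Hurwitz order -/

/-! The first columns of `P` belong to classical forms, and on classical forms of trace zero `U₅`
is, up to sign, an Atkin–Lehner operator, which reverses degrees. A vector supported in low degrees
and of trace zero is therefore sent to high degrees, outside the upper left block, and lies in the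
kernel of that block.

In detail, class number one and the simply transitive action of the 24 Hurwitz units on the nonzero
vectors of `𝔽_5²` give `D_fˣ = Dˣ Γ̂₁(5)` with `Dˣ ∩ Γ̂₁(5) = 1` (`exists_decomposition`,
`eq_one_of_inLevel`). A form is thus the same thing as its value at 1, and classical forms are the
polynomials of degree at most `k - 2`. The `a`-part consists of those supported in degrees congruent
to `a` modulo 4 (`mem_classicalFormsPart_iff`). There are `d = (k + 2 - a) / 4` such degrees, and
`dIw ≤ d` (`dIw_le`). The congruence between `k` and `a` says that the quaternion `j` acts
trivially, so these forms have level `Γ₀(5)` with trivial character (`apply_of_inLevel_Iw0`).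

The trace to level `GL₂(ℤ_5)` is a sum over the six points of `ℙ¹(𝔽_5)`. After composition with
`v_0`, five of its terms make up `U₅` and the sixth is the Atkin–Lehner translate
(`classicalU5_of_trace_eq_zero`). The element `i + 2k` of norm 5 has an antidiagonal image at 5, so
that translate exchanges the degrees `m` and `k - 2 - m` (`atkinLehner_apply_one`), that is, the
indices `j` and `d - 1 - j`.

If `e ≤ n` and `n + e ≤ d`, the combinations of the first `e` monomials whose trace vanishes form a
space of dimension at least `e - dUnr`, and the `n × n` block kills them (`le_corank`). The theorem
is the case `e = min(n, dIw - n)`. -/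

theorem mem_hurwitz_iff {p : Nat.Primes} {x : ℍ[ℚ_[(p : ℕ)]]} :
    x ∈ hurwitz p ↔ ‖x.re - x.imK‖ ≤ 1 ∧ ‖x.imI - x.imK‖ ≤ 1 ∧ ‖x.imJ - x.imK‖ ≤ 1 ∧
      ‖2 * x.imK‖ ≤ 1 := by
  constructor
  · rintro ⟨a, b, c, d, rfl⟩
    refine ⟨?_, ?_, ?_, ?_⟩
    · simpa using a.2
    · simpa using b.2
    · simpa using c.2
    · simpa [mul_div_cancel₀] using d.2
  · rintro ⟨h₁, h₂, h₃, h₄⟩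
    refine ⟨⟨_, h₁⟩, ⟨_, h₂⟩, ⟨_, h₃⟩, ⟨_, h₄⟩, ?_⟩
    ext <;> simp

/-- The maximal order `ℤ + ℤ i + ℤ j + ℤ (1 + i + j + k) / 2` of `ℍ[ℚ]`. -/
def hurwitzOrder : Subring ℍ[ℚ] where
  carrier := {x | ∃ a b c d : ℤ,
    x = quat ((a : ℚ) + d / 2) ((b : ℚ) + d / 2) ((c : ℚ) + d / 2) ((d : ℚ) / 2)}
  zero_mem' := ⟨0, 0, 0, 0, by ext <;> simp⟩
  one_mem' := ⟨1, 0, 0, 0, by ext <;> simp⟩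
  add_mem' := by
    rintro _ _ ⟨a, b, c, d, rfl⟩ ⟨a', b', c', d', rfl⟩
    exact ⟨a + a', b + b', c + c', d + d', by ext <;> simp <;> ring⟩
  neg_mem' := by
    rintro _ ⟨a, b, c, d, rfl⟩
    exact ⟨-a, -b, -c, -d, by ext <;> simp <;> ring⟩
  mul_mem' := by
    rintro _ _ ⟨a, b, c, d, rfl⟩ ⟨a', b', c', d', rfl⟩
    refine ⟨a * a' - b * b' - c * c' - d * d' - b * d' - d * c' - b * c' + c * b',
      a * b' + b * a' + d * b' + c * d' - d * c' - b * c' + c * b',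
      a * c' + c * a' - b * d' + c * d' + d * b' - b * c' + c * b',
      a * d' + d * a' + d * d' + b * c' + b * c' + b * d' + d * c' - c * b' - c * b' - c * d' -
        d * b',
      ?_⟩
    ext <;> simp <;> ring

theorem localMap_mem_hurwitz {x : ℍ[ℚ]} (hx : x ∈ hurwitzOrder) (p : Nat.Primes) :
    localMap p x ∈ hurwitz p := by
  obtain ⟨a, b, c, d, rfl⟩ := hx
  exact ⟨a, b, c, d, by rw [localMap_apply]; ext <;> simp⟩

theorem quat_intCast_mem (a b c d : ℤ) : quat (a : ℚ) b c d ∈ hurwitzOrder :=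
  ⟨a - d, b - d, c - d, 2 * d, by ext <;> simp⟩

theorem normSq_eq (x : ℍ[ℚ]) :
    Quaternion.normSq x = x.re ^ 2 + x.imI ^ 2 + x.imJ ^ 2 + x.imK ^ 2 :=
  Quaternion.normSq_def' x

/-- The Hurwitz order is norm-Euclidean. -/
theorem exists_normSq_sub_lt_one (x : ℍ[ℚ]) :
    ∃ q ∈ hurwitzOrder, Quaternion.normSq (x - q) < 1 := by
  have key : ∀ t : ℚ, (t - round t) ^ 2 ≤ 1 / 4 := fun t => by
    have := abs_le.mp (abs_sub_round t)
    nlinarith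
  have half : ∀ t : ℚ, (t - round t) ^ 2 = 1 / 4 → ∃ s : ℤ, t = s + 1 / 2 := fun t ht => by
    have : (t - round t - 1 / 2) * (t - round t + 1 / 2) = 0 := by linear_combination ht
    rcases mul_eq_zero.mp this with h | h
    · exact ⟨round t, by linear_combination h⟩
    · exact ⟨round t - 1, by push_cast; linear_combination h⟩
  -- Rounding each coordinate leaves norm at most `4 · 1/4`, with equality only if all four
  -- coordinates are half-integers. In that case `x` itself lies in the order.
  by_cases h : Quaternion.normSq
      (x - quat (round x.re : ℚ) (round x.imI) (round x.imJ) (round x.imK)) < 1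
  · exact ⟨_, quat_intCast_mem _ _ _ _, h⟩
  · rw [normSq_eq] at h
    simp only [Quaternion.re_sub, Quaternion.imI_sub, Quaternion.imJ_sub, Quaternion.imK_sub,
      quat_re, quat_imI, quat_imJ, quat_imK, not_lt] at h
    have h₁ := key x.re
    have h₂ := key x.imI
    have h₃ := key x.imJ
    have h₄ := key x.imK
    obtain ⟨a, ha⟩ := half x.re (by linarith)
    obtain ⟨b, hb⟩ := half x.imI (by linarith)
    obtain ⟨c, hc⟩ := half x.imJ (by linarith)
    obtain ⟨d, hd⟩ := half x.imK (by linarith)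
    refine ⟨x, ⟨a - d, b - d, c - d, 2 * d + 1, ?_⟩, by simp⟩
    ext <;> simp <;> linarith

/-- The factor 4 clears the half-integral coordinates; all that is needed is a quantity in `ℕ` for
the Euclidean descent. -/
theorem exists_nat_four_mul_normSq {x : ℍ[ℚ]} (hx : x ∈ hurwitzOrder) :
    ∃ n : ℕ, (n : ℚ) = 4 * Quaternion.normSq x := by
  obtain ⟨a, b, c, d, rfl⟩ := hx
  refine ⟨((2 * a + d) ^ 2 + (2 * b + d) ^ 2 + (2 * c + d) ^ 2 + d ^ 2).toNat, ?_⟩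
  have h : ((((2 * a + d) ^ 2 + (2 * b + d) ^ 2 + (2 * c + d) ^ 2 + d ^ 2).toNat : ℤ) : ℚ) =
      (((2 * a + d) ^ 2 + (2 * b + d) ^ 2 + (2 * c + d) ^ 2 + d ^ 2 : ℤ) : ℚ) := by
    rw [Int.toNat_of_nonneg (by positivity)]
  rw [Int.cast_natCast] at h
  rw [h, normSq_eq]
  push_cast
  simp only [quat_re, quat_imI, quat_imJ, quat_imK]
  ring

/-- Every right ideal of the Hurwitz order is principal. -/
theorem exists_generator (I : AddSubgroup ℍ[ℚ]) (hI : ∀ x ∈ I, x ∈ hurwitzOrder)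
    (hmul : ∀ x ∈ I, ∀ q ∈ hurwitzOrder, x * q ∈ I) (hne : ∃ x ∈ I, x ≠ 0) :
    ∃ δ ∈ I, δ ≠ 0 ∧ ∀ x ∈ I, ∃ q ∈ hurwitzOrder, x = δ * q := by
  classical
  have hex : ∃ n : ℕ, ∃ x ∈ I, x ≠ 0 ∧ (n : ℚ) = 4 * Quaternion.normSq x := by
    obtain ⟨x, hx, hx0⟩ := hne
    obtain ⟨n, hn⟩ := exists_nat_four_mul_normSq (hI x hx)
    exact ⟨n, x, hx, hx0, hn⟩
  obtain ⟨δ, hδ, hδ0, hδn⟩ := Nat.find_spec hex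
  refine ⟨δ, hδ, hδ0, fun x hx => ?_⟩
  -- `δ` has least norm among the nonzero elements of `I`, and the remainder `δ (δ⁻¹ x - q)` lies in
  -- `I` with smaller norm, so it vanishes.
  obtain ⟨q, hq, hlt⟩ := exists_normSq_sub_lt_one (δ⁻¹ * x)
  refine ⟨q, hq, ?_⟩
  by_contra hne
  have hmem : x - δ * q ∈ I := I.sub_mem hx (hmul δ hδ q hq)
  have hr : x - δ * q = δ * (δ⁻¹ * x - q) := by
    rw [mul_sub, mul_inv_cancel_left₀ hδ0]
  obtain ⟨n, hn⟩ := exists_nat_four_mul_normSq (hI _ hmem)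
  refine Nat.find_min hex (m := n) ?_ ⟨_, hmem, sub_ne_zero.mpr hne, hn⟩
  have hpos : 0 < Quaternion.normSq δ :=
    lt_of_le_of_ne Quaternion.normSq_nonneg (Ne.symm (Quaternion.normSq_ne_zero.mpr hδ0))
  have : (n : ℚ) < (Nat.find hex : ℕ) := by
    rw [hn, hδn, hr, map_mul]
    nlinarith
  exact_mod_cast this

/-! ### Class number one -/

theorem mem_localUnits {p : Nat.Primes} {x : (ℍ[ℚ_[(p : ℕ)]])ˣ} :
    x ∈ localUnits p ↔ (x : ℍ[ℚ_[(p : ℕ)]]) ∈ hurwitz p ∧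
      ((x⁻¹ : (ℍ[ℚ_[(p : ℕ)]])ˣ) : ℍ[ℚ_[(p : ℕ)]]) ∈ hurwitz p := Iff.rfl

theorem quat_coe_mem_hurwitz {p : Nat.Primes} (a b c d : ℤ_[(p : ℕ)]) :
    quat (a : ℚ_[(p : ℕ)]) b c d ∈ hurwitz p :=
  ⟨a - d, b - d, c - d, d + d, by ext <;> simp⟩

theorem exists_pow_mul_norm_le_one (p : Nat.Primes) (x : ℚ_[(p : ℕ)]) :
    ∃ m : ℕ, ∀ n ≥ m, ‖((p : ℕ) : ℚ_[(p : ℕ)]) ^ n * x‖ ≤ 1 := by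
  have h : Tendsto (fun n : ℕ => ‖((p : ℕ) : ℚ_[(p : ℕ)]) ^ n * x‖) atTop (𝓝 0) := by
    have : Tendsto (fun n : ℕ => ((p : ℕ) : ℚ_[(p : ℕ)]) ^ n * x) atTop (𝓝 (0 * x)) :=
      (tendsto_pow_atTop_nhds_zero_of_norm_lt_one Padic.norm_p_lt_one).mul_const x
    simpa using this.norm
  exact eventually_atTop.mp (h.eventually_le_const zero_lt_one)

theorem natCast_pow_eq (p : Nat.Primes) (n : ℕ) :
    ((p : ℕ) : ℍ[ℚ_[(p : ℕ)]]) ^ n = quat (((p : ℕ) : ℚ_[(p : ℕ)]) ^ n) 0 0 0 := by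
  have h : ((p : ℕ) : ℍ[ℚ_[(p : ℕ)]]) ^ n =
      ((((p : ℕ) : ℚ_[(p : ℕ)]) ^ n : ℚ_[(p : ℕ)]) : ℍ[ℚ_[(p : ℕ)]]) := by
    push_cast; rfl
  rw [h]
  rfl

theorem exists_pow_mul_mem_hurwitz (p : Nat.Primes) (x : ℍ[ℚ_[(p : ℕ)]]) :
    ∃ m : ℕ, ((p : ℕ) : ℍ[ℚ_[(p : ℕ)]]) ^ m * x ∈ hurwitz p := by
  obtain ⟨m₁, h₁⟩ := exists_pow_mul_norm_le_one p x.re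
  obtain ⟨m₂, h₂⟩ := exists_pow_mul_norm_le_one p x.imI
  obtain ⟨m₃, h₃⟩ := exists_pow_mul_norm_le_one p x.imJ
  obtain ⟨m₄, h₄⟩ := exists_pow_mul_norm_le_one p x.imK
  refine ⟨m₁ + m₂ + m₃ + m₄, ?_⟩
  have := quat_coe_mem_hurwitz (p := p) ⟨_, h₁ (m₁ + m₂ + m₃ + m₄) (by lia)⟩
    ⟨_, h₂ (m₁ + m₂ + m₃ + m₄) (by lia)⟩ ⟨_, h₃ (m₁ + m₂ + m₃ + m₄) (by lia)⟩
    ⟨_, h₄ (m₁ + m₂ + m₃ + m₄) (by lia)⟩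
  convert this using 1
  rw [natCast_pow_eq]
  ext <;> simp

/-- Density of the Hurwitz order in its completion at `p`. -/
theorem exists_hurwitzOrder_approx (p : Nat.Primes) (e : ℕ) {x : ℍ[ℚ_[(p : ℕ)]]}
    (hx : x ∈ hurwitz p) : ∃ y ∈ hurwitzOrder, ∃ w ∈ hurwitz p,
      localMap p y = x + ((p : ℕ) : ℍ[ℚ_[(p : ℕ)]]) ^ e * w := by
  have key : ∀ a : ℤ_[(p : ℕ)], ∃ (n : ℤ) (w : ℤ_[(p : ℕ)]),
      (n : ℚ_[(p : ℕ)]) = a + ((p : ℕ) : ℚ_[(p : ℕ)]) ^ e * w := fun a => by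
    obtain ⟨w, hw⟩ := Ideal.mem_span_singleton'.mp (PadicInt.appr_spec e a)
    refine ⟨a.appr e, -w, ?_⟩
    have := congrArg (fun x : ℤ_[(p : ℕ)] => (x : ℚ_[(p : ℕ)])) hw
    push_cast at this ⊢
    linear_combination this
  obtain ⟨a, b, c, d, rfl⟩ := hx
  obtain ⟨a', wa, ha⟩ := key a
  obtain ⟨b', wb, hb⟩ := key b
  obtain ⟨c', wc, hc⟩ := key c
  obtain ⟨d', wd, hd⟩ := key d
  refine ⟨_, ⟨a', b', c', d', rfl⟩, _, ⟨wa, wb, wc, wd, rfl⟩, ?_⟩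
  rw [localMap_apply, natCast_pow_eq]
  ext <;> simp [ha, hb, hc, hd] <;> ring

theorem mem_localUnits_of_mul_eq_one {p : Nat.Primes} {x : (ℍ[ℚ_[(p : ℕ)]])ˣ}
    {y : ℍ[ℚ_[(p : ℕ)]]} (hx : (x : ℍ[ℚ_[(p : ℕ)]]) ∈ hurwitz p) (hy : y ∈ hurwitz p)
    (h : (x : ℍ[ℚ_[(p : ℕ)]]) * y = 1) : x ∈ localUnits p :=
  mem_localUnits.mpr ⟨hx, by rwa [Units.inv_eq_of_mul_eq_one_right h]⟩

/-- The image of `δ` in `(D ⊗ ℚ_p)ˣ`. -/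
noncomputable abbrev localUnit (p : Nat.Primes) : (ℍ[ℚ])ˣ →* (ℍ[ℚ_[(p : ℕ)]])ˣ :=
  Units.map (localMap p).toMonoidHom

@[simp] theorem coe_localUnit (p : Nat.Primes) (δ : (ℍ[ℚ])ˣ) :
    (localUnit p δ : ℍ[ℚ_[(p : ℕ)]]) = localMap p δ := rfl

@[simp] theorem diag_apply (δ : (ℍ[ℚ])ˣ) (p : Nat.Primes) : diag δ p = localUnit p δ := rfl

theorem natCast_pow_ne_zero (p : Nat.Primes) (e : ℕ) : ((p : ℕ) : ℍ[ℚ]) ^ e ≠ 0 := by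
  refine pow_ne_zero _ fun h => p.2.ne_zero ?_
  have : (((p : ℕ) : ℚ) : ℍ[ℚ]) = ((0 : ℚ) : ℍ[ℚ]) := by simpa using h
  exact_mod_cast Quaternion.coe_injective this

theorem exists_pow_mul_eq_one {p q : Nat.Primes} (h : q ≠ p) (e : ℕ) :
    ∃ y ∈ hurwitz q, ((p : ℕ) : ℍ[ℚ_[(q : ℕ)]]) ^ e * y = 1 := by
  have hp : ‖((p : ℕ) : ℚ_[(q : ℕ)])‖ = 1 :=
    Padic.norm_natCast_eq_one_iff.mpr <| (Nat.coprime_primes q.2 p.2).mpr fun h' =>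
      h (Subtype.ext h')
  have hp0 : ((p : ℕ) : ℚ_[(q : ℕ)]) ^ e ≠ 0 := pow_ne_zero _ (Nat.cast_ne_zero.mpr p.2.ne_zero)
  have h₁ : ‖(((p : ℕ) : ℚ_[(q : ℕ)]) ^ e)⁻¹‖ ≤ 1 := by rw [norm_inv, norm_pow, hp]; simp
  refine ⟨_, quat_coe_mem_hurwitz (p := q) ⟨_, h₁⟩ 0 0 0, ?_⟩
  have h2 : ((p : ℕ) : ℍ[ℚ_[(q : ℕ)]]) ^ e = quat (((p : ℕ) : ℚ_[(q : ℕ)]) ^ e) 0 0 0 := by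
    have h : ((p : ℕ) : ℍ[ℚ_[(q : ℕ)]]) ^ e =
        ((((p : ℕ) : ℚ_[(q : ℕ)]) ^ e : ℚ_[(q : ℕ)]) : ℍ[ℚ_[(q : ℕ)]]) := by
      push_cast; rfl
    rw [h]
    rfl
  rw [h2]
  ext <;> simp [hp0]

/-- An integral element at `p` agrees, up to units, with a global element that is a unit away
from `p`. -/
theorem exists_global_of_mem_hurwitz (p : Nat.Primes) (x : (ℍ[ℚ_[(p : ℕ)]])ˣ)
    (hx : (x : ℍ[ℚ_[(p : ℕ)]]) ∈ hurwitz p) : ∃ δ : (ℍ[ℚ])ˣ,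
      (∀ q ≠ p, localUnit q δ ∈ localUnits q) ∧ (localUnit p δ)⁻¹ * x ∈ localUnits p := by
  -- Take `y` in the order with `y = x + p^e w` at `p`, where `p^e x⁻¹` is integral, and a generator
  -- `δ` of the right ideal generated by `y` and `p^e`. Since `δ` divides `p^e`, it is a unit away
  -- from `p`. At `p`, `x = y - p^e w` is a multiple of `δ`, and conversely `y` and `p^e = x (p^e
  -- x⁻¹)` are multiples of `x`, so `δ` and `x` differ by a unit.
  obtain ⟨e, he⟩ := exists_pow_mul_mem_hurwitz p ((x⁻¹ : (ℍ[ℚ_[(p : ℕ)]])ˣ) : ℍ[ℚ_[(p : ℕ)]])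
  obtain ⟨y, hy, w, hw, hyw⟩ := exists_hurwitzOrder_approx p e hx
  set N : ℍ[ℚ] := ((p : ℕ) : ℍ[ℚ]) ^ e with hN
  have hNH : N ∈ hurwitzOrder := pow_mem (natCast_mem _ _) _
  have hNloc : ∀ q, localMap q N = ((p : ℕ) : ℍ[ℚ_[(q : ℕ)]]) ^ e := fun q => by
    rw [hN, map_pow, map_natCast]
  have hN0 : N ≠ 0 := natCast_pow_ne_zero p e
  let I : AddSubgroup ℍ[ℚ] :=
    { carrier := {z | ∃ u ∈ hurwitzOrder, ∃ v ∈ hurwitzOrder, z = y * u + N * v}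
      zero_mem' := ⟨0, zero_mem _, 0, zero_mem _, by simp⟩
      add_mem' := by
        rintro _ _ ⟨u, hu, v, hv, rfl⟩ ⟨u', hu', v', hv', rfl⟩
        exact ⟨u + u', add_mem hu hu', v + v', add_mem hv hv', by noncomm_ring⟩
      neg_mem' := by
        rintro _ ⟨u, hu, v, hv, rfl⟩
        exact ⟨-u, neg_mem hu, -v, neg_mem hv, by noncomm_ring⟩ }
  have hyI : y ∈ I := ⟨1, one_mem _, 0, zero_mem _, by simp⟩
  have hNI : N ∈ I := ⟨0, zero_mem _, 1, one_mem _, by simp⟩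
  have hIH : ∀ z ∈ I, z ∈ hurwitzOrder := by
    rintro _ ⟨u, hu, v, hv, rfl⟩
    exact add_mem (mul_mem hy hu) (mul_mem hNH hv)
  obtain ⟨δ, hδI, hδ0, hδ⟩ := exists_generator I hIH (by
    rintro _ ⟨u, hu, v, hv, rfl⟩ q hq
    exact ⟨u * q, mul_mem hu hq, v * q, mul_mem hv hq, by noncomm_ring⟩) ⟨N, hNI, hN0⟩
  obtain ⟨q₁, hq₁, h₁⟩ := hδ y hyI
  obtain ⟨q₂, hq₂, h₂⟩ := hδ N hNI
  refine ⟨Units.mk0 δ hδ0, fun q hq => ?_, ?_⟩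
  · obtain ⟨t, ht, hpt⟩ := exists_pow_mul_eq_one hq e
    refine mem_localUnits_of_mul_eq_one (y := localMap q q₂ * t)
      (localMap_mem_hurwitz (hIH _ hδI) q) (mul_mem (localMap_mem_hurwitz hq₂ q) ht) ?_
    rw [coe_localUnit, Units.val_mk0, ← mul_assoc, ← map_mul, ← h₂, hNloc, hpt]
  · obtain ⟨u, hu, v, hv, huv⟩ := hδI
    have e₁ : (((localUnit p (Units.mk0 δ hδ0))⁻¹ * x : (ℍ[ℚ_[(p : ℕ)]])ˣ) : ℍ[ℚ_[(p : ℕ)]]) =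
        localMap p q₁ - localMap p q₂ * w := by
      rw [Units.val_mul, Units.inv_mul_eq_iff_eq_mul, coe_localUnit, Units.val_mk0, mul_sub,
        ← mul_assoc, ← map_mul, ← map_mul, ← h₁, ← h₂, hyw, hNloc]
      abel
    have e₂ : ((((localUnit p (Units.mk0 δ hδ0))⁻¹ * x)⁻¹ : (ℍ[ℚ_[(p : ℕ)]])ˣ) :
        ℍ[ℚ_[(p : ℕ)]]) =
        (1 + localMap p N * ((x⁻¹ : (ℍ[ℚ_[(p : ℕ)]])ˣ) : ℍ[ℚ_[(p : ℕ)]]) * w) * localMap p u +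
          localMap p N * ((x⁻¹ : (ℍ[ℚ_[(p : ℕ)]])ˣ) : ℍ[ℚ_[(p : ℕ)]]) * localMap p v := by
      have hc : ∀ z, (x : ℍ[ℚ_[(p : ℕ)]]) *
          (localMap p N * ((x⁻¹ : (ℍ[ℚ_[(p : ℕ)]])ˣ) : ℍ[ℚ_[(p : ℕ)]]) * z) =
          localMap p N * z := fun z => by
        rw [hNloc, mul_assoc, ← mul_assoc, ← ((Nat.cast_commute _ _).pow_left _).eq, mul_assoc,
          Units.mul_inv_cancel_left]
      rw [mul_inv_rev, inv_inv, Units.val_mul, Units.inv_mul_eq_iff_eq_mul, coe_localUnit,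
        Units.val_mk0, mul_add, hc, ← mul_assoc, mul_add, hc, mul_one, hNloc, ← hyw, huv,
        map_add, map_mul, map_mul, hNloc]
    rw [← hNloc] at he
    refine ⟨?_, ?_⟩
    · change (((localUnit p (Units.mk0 δ hδ0))⁻¹ * x : (ℍ[ℚ_[(p : ℕ)]])ˣ) : ℍ[ℚ_[(p : ℕ)]]) ∈
        hurwitz p
      rw [e₁]
      exact sub_mem (localMap_mem_hurwitz hq₁ p) (mul_mem (localMap_mem_hurwitz hq₂ p) hw)
    · change ((((localUnit p (Units.mk0 δ hδ0))⁻¹ * x)⁻¹ : (ℍ[ℚ_[(p : ℕ)]])ˣ) :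
        ℍ[ℚ_[(p : ℕ)]]) ∈ hurwitz p
      rw [e₂]
      exact add_mem (mul_mem (add_mem (one_mem _) (mul_mem he hw)) (localMap_mem_hurwitz hu p))
        (mul_mem he (localMap_mem_hurwitz hv p))

/-- A power of `p` makes `x` integral and is a unit at every other prime, which reduces to the
integral case. -/
theorem exists_global (p : Nat.Primes) (x : (ℍ[ℚ_[(p : ℕ)]])ˣ) : ∃ δ : (ℍ[ℚ])ˣ,
    (∀ q ≠ p, localUnit q δ ∈ localUnits q) ∧ localUnit p δ * x ∈ localUnits p := by
  obtain ⟨m, hm⟩ := exists_pow_mul_mem_hurwitz p (x : ℍ[ℚ_[(p : ℕ)]])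
  have hN0 : ((p : ℕ) : ℍ[ℚ]) ^ m ≠ 0 := natCast_pow_ne_zero p m
  have hloc : ∀ q : Nat.Primes, (localUnit q (Units.mk0 _ hN0) : ℍ[ℚ_[(q : ℕ)]]) =
      ((p : ℕ) : ℍ[ℚ_[(q : ℕ)]]) ^ m := fun q => by
    rw [coe_localUnit, Units.val_mk0, map_pow, map_natCast]
  obtain ⟨δ, h₁, h₂⟩ := exists_global_of_mem_hurwitz p (localUnit p (Units.mk0 _ hN0) * x)
    (by rw [Units.val_mul, hloc]; exact hm)
  refine ⟨δ⁻¹ * Units.mk0 _ hN0, fun q hq => ?_, ?_⟩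
  · rw [map_mul, map_inv]
    obtain ⟨t, ht, hpt⟩ := exists_pow_mul_eq_one hq m
    refine mul_mem (inv_mem (h₁ q hq)) (mem_localUnits_of_mul_eq_one ?_ ht (by rwa [hloc]))
    rw [hloc]
    exact pow_mem (natCast_mem _ _) _
  · rwa [map_mul, map_inv, mul_assoc]

/-- The Hurwitz order has class number one. -/
theorem exists_diag_mul_mem (g : AdelicUnits) :
    ∃ δ : (ℍ[ℚ])ˣ, ∀ p, (diag δ * g) p ∈ localUnits p := by
  classical
  -- Induction on the set of bad primes: the correction at `p` is a unit at all other primes, so it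
  -- does not spoil those already treated.
  have key : ∀ (S : Finset Nat.Primes) (g : AdelicUnits), (∀ p ∉ S, g p ∈ localUnits p) →
      ∃ δ : (ℍ[ℚ])ˣ, ∀ p, (diag δ * g) p ∈ localUnits p := by
    intro S
    induction S using Finset.induction_on with
    | empty => exact fun g hg => ⟨1, fun p => by simpa using hg p (by simp)⟩
    | insert p S _ ih =>
      intro g hg
      obtain ⟨δ, h₁, h₂⟩ := exists_global p (g p)
      obtain ⟨ε, hε⟩ := ih (diag δ * g) fun q hq => by
        rw [RestrictedProduct.mul_apply, diag_apply]
        by_cases hqp : q = p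
        · subst hqp; exact h₂
        · exact mul_mem (h₁ q hqp) (hg q (by simp [hqp, hq]))
      exact ⟨ε * δ, by rwa [map_mul, mul_assoc]⟩
  have hfin : {p | g p ∉ localUnits p}.Finite := g.eventually
  exact key hfin.toFinset g fun p hp => by simpa using hp

/-! ### Matrices over `ℤ_5` -/

/-- The inclusion `M₂(ℤ_5) ⊆ M₂(ℚ_5)`. -/
noncomputable abbrev toQ (γ : Matrix (Fin 2) (Fin 2) ℤ_[5]) : Matrix (Fin 2) (Fin 2) ℚ_[5] :=
  γ.map (fun x : ℤ_[5] => (x : ℚ_[5]))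

theorem toQ_mul (γ γ' : Matrix (Fin 2) (Fin 2) ℤ_[5]) : toQ (γ * γ') = toQ γ * toQ γ' :=
  Matrix.map_mul (f := PadicInt.Coe.ringHom)

@[simp] theorem toQ_one : toQ 1 = 1 := by
  ext i j
  fin_cases i <;> fin_cases j <;> simp

theorem toQ_injective : Function.Injective toQ := fun γ γ' h => by
  ext i j
  exact PadicInt.ext (congrFun (congrFun h i) j)

theorem norm_two : ‖(2 : ℚ_[5])‖ = 1 := by
  have := (Padic.norm_natCast_eq_one_iff (p := 5) (n := 2)).mpr (by decide)
  exact_mod_cast this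

theorem two_smul_mem {x : ℚ_[5]} (h : ‖2 * x‖ ≤ 1) : ‖x‖ ≤ 1 := by
  rwa [norm_mul, norm_two, one_mul] at h

/-- `split` and its inverse involve only `ν`, which is integral, and division by 2, a unit at 5. -/
theorem mem_hurwitz_five_iff {x : ℍ[ℚ_[5]]} : x ∈ hurwitz five ↔ ∃ γ, split x = toQ γ := by
  constructor
  · intro hx
    obtain ⟨h₁, h₂, h₃, h₄⟩ := mem_hurwitz_iff.mp hx
    have hk : ‖x.imK‖ ≤ 1 := two_smul_mem h₄
    have key : ∀ y : ℚ_[5], ‖y - x.imK‖ ≤ 1 → ‖y‖ ≤ 1 := fun y hy => by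
      have := (PadicInt.subring 5).add_mem (x := y - x.imK) (y := x.imK) hy hk
      rwa [sub_add_cancel] at this
    refine ⟨!![⟨_, key _ h₁⟩ + ⟨_, key _ h₃⟩ * nu, ⟨_, key _ h₂⟩ - ⟨_, hk⟩ * nu;
      -⟨_, key _ h₂⟩ - ⟨_, hk⟩ * nu, ⟨_, key _ h₁⟩ - ⟨_, key _ h₃⟩ * nu], ?_⟩
    ext i j
    fin_cases i <;> fin_cases j <;> rfl
  · rintro ⟨γ, hγ⟩
    obtain rfl : x = split.symm (toQ γ) := by rw [← hγ, RingEquiv.symm_apply_apply]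
    have key : ∀ y : ℤ_[5], ‖(y : ℚ_[5]) / 2‖ ≤ 1 := fun y =>
      two_smul_mem (by rw [mul_div_cancel₀ _ (two_ne_zero)]; exact y.2)
    have := quat_coe_mem_hurwitz (p := five) ⟨_, key (γ 0 0 + γ 1 1)⟩ ⟨_, key (γ 0 1 - γ 1 0)⟩
      ⟨_, key (-(nu * (γ 0 0 - γ 1 1)))⟩ ⟨_, key (nu * (γ 0 1 + γ 1 0))⟩
    convert this using 1
    change quat _ _ _ _ = _
    simp [toQ]

/-- Reduction modulo `5`. -/
noncomputable abbrev red : ℤ_[5] →+* ZMod 5 := PadicInt.toZMod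

theorem red_eq_zero_iff {x : ℤ_[5]} : red x = 0 ↔ (5 : ℤ_[5]) ∣ x := by
  rw [← RingHom.mem_ker, PadicInt.ker_toZMod, PadicInt.maximalIdeal_eq_span_p,
    Ideal.mem_span_singleton]
  norm_num

theorem red_ne_zero_iff {x : ℤ_[5]} : red x ≠ 0 ↔ IsUnit x := by
  rw [Ne, ← RingHom.mem_ker, PadicInt.ker_toZMod, IsLocalRing.mem_maximalIdeal, mem_nonunits_iff,
    not_not]

@[simp] theorem red_nu : red nu = 2 := by
  have := red_eq_zero_iff.mpr five_dvd_nu_sub_two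
  rw [map_sub, map_ofNat] at this
  linear_combination this

/-- The bottom row of a matrix modulo `5`. -/
noncomputable def bottomRow (γ : Matrix (Fin 2) (Fin 2) ℤ_[5]) : Fin 2 → ZMod 5 :=
  red.mapMatrix γ 1

theorem bottomRow_mul (γ γ' : Matrix (Fin 2) (Fin 2) ℤ_[5]) :
    bottomRow (γ * γ') = Matrix.vecMul (bottomRow γ) (red.mapMatrix γ') := by
  rw [bottomRow, map_mul, Matrix.mul_apply_eq_vecMul]
  rfl

theorem bottomRow_eq (γ : Matrix (Fin 2) (Fin 2) ℤ_[5]) :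
    bottomRow γ = ![red (γ 1 0), red (γ 1 1)] := by
  ext i
  fin_cases i <;> rfl

theorem bottomRow_one : bottomRow 1 = ![0, 1] := by simp [bottomRow_eq]

/-- This presents `Iw` as the stabilizer of the row `(0, 1)` modulo 5. Closure under products and
inverses, and all later coset computations, then follow from `bottomRow_mul`. -/
theorem mem_Iw_iff {γ : Matrix (Fin 2) (Fin 2) ℤ_[5]} :
    γ ∈ Iw ↔ IsUnit γ ∧ bottomRow γ = ![0, 1] := by
  have h2 : bottomRow γ = ![0, 1] ↔ red (γ 1 0) = 0 ∧ red (γ 1 1) = 1 := by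
    rw [bottomRow_eq]
    simp [funext_iff]
  have h3 : red (γ 1 1) = 1 ↔ (5 : ℤ_[5]) ∣ γ 1 1 - 1 := by
    rw [← red_eq_zero_iff, map_sub, map_one, sub_eq_zero]
  rw [h2, Matrix.isUnit_iff_isUnit_det, ← red_ne_zero_iff, Matrix.det_fin_two]
  change IsUnit (γ 0 0) ∧ _ ↔ _
  rw [← red_ne_zero_iff, ← red_eq_zero_iff, ← h3, map_sub, map_mul, map_mul]
  constructor
  · rintro ⟨h, h', h''⟩
    exact ⟨by rw [h', h'']; simpa using h, h', h''⟩
  · rintro ⟨h, h', h''⟩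
    rw [h', h''] at h
    exact ⟨by simpa using h, h', h''⟩

theorem Iw_mul {γ γ' : Matrix (Fin 2) (Fin 2) ℤ_[5]} (h : γ ∈ Iw) (h' : γ' ∈ Iw) :
    γ * γ' ∈ Iw := by
  rw [mem_Iw_iff] at *
  refine ⟨h.1.mul h'.1, ?_⟩
  rw [bottomRow_mul, h.2, ← bottomRow_one, ← bottomRow_mul, one_mul, h'.2, bottomRow_one]

theorem Iw_of_mul_eq_one {γ γ' : Matrix (Fin 2) (Fin 2) ℤ_[5]} (h : γ ∈ Iw) (h' : γ * γ' = 1) :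
    γ' ∈ Iw := by
  rw [mem_Iw_iff] at *
  refine ⟨IsUnit.of_mul_eq_one γ (mul_eq_one_comm.mp h'), ?_⟩
  rw [← one_mul γ', bottomRow_mul, bottomRow_one, ← h.2, ← bottomRow_mul, h', bottomRow_one, h.2]

theorem one_mem_Iw : (1 : Matrix (Fin 2) (Fin 2) ℤ_[5]) ∈ Iw :=
  mem_Iw_iff.mpr ⟨isUnit_one, bottomRow_one⟩

/-! ### The level group `Γ̂₁(5)` -/

theorem InLevel.mul {u u' : AdelicUnits} {γ γ' : Matrix (Fin 2) (Fin 2) ℤ_[5]}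
    (h : InLevel Iw u γ) (h' : InLevel Iw u' γ') : InLevel Iw (u * u') (γ * γ') := by
  refine ⟨fun p hp => mul_mem (h.1 p hp) (h'.1 p hp), Iw_mul h.2.1 h'.2.1, ?_⟩
  rw [RestrictedProduct.mul_apply, Units.val_mul, map_mul, h.2.2, h'.2.2]
  exact (toQ_mul _ _).symm

theorem InLevel.one : InLevel Iw 1 1 := by
  refine ⟨fun p _ => one_mem _, one_mem_Iw, ?_⟩
  rw [RestrictedProduct.one_apply, Units.val_one, map_one]
  exact toQ_one.symm

theorem InLevel.exists_inv {u : AdelicUnits} {γ : Matrix (Fin 2) (Fin 2) ℤ_[5]}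
    (h : InLevel Iw u γ) : ∃ γ', γ * γ' = 1 ∧ InLevel Iw u⁻¹ γ' := by
  obtain ⟨w, hw⟩ := (mem_Iw_iff.mp h.2.1).1
  have h1 : γ * (w⁻¹ : (Matrix (Fin 2) (Fin 2) ℤ_[5])ˣ) = 1 := by rw [← hw]; exact w.mul_inv
  refine ⟨_, h1, fun p hp => inv_mem (h.1 p hp), Iw_of_mul_eq_one h.2.1 h1, ?_⟩
  have h2 : split (u five : ℍ[ℚ_[5]]) * split ((u⁻¹ : AdelicUnits) five : ℍ[ℚ_[5]]) = 1 := by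
    rw [← map_mul, RestrictedProduct.inv_apply, Units.mul_inv, map_one]
  have h3 := congrArg toQ h1
  rw [toQ_mul, toQ_one] at h3
  rw [h.2.2] at h2
  exact left_inv_eq_right_inv (mul_eq_one_comm.mp h2) h3

theorem InLevel.unique {K : Set (Matrix (Fin 2) (Fin 2) ℤ_[5])} {u : AdelicUnits}
    {γ γ' : Matrix (Fin 2) (Fin 2) ℤ_[5]} (h : InLevel K u γ) (h' : InLevel K u γ') : γ = γ' :=
  toQ_injective (h.2.2.symm.trans h'.2.2)

/-- A finite search. The coordinates refer to the basis `1, i, j, (1 + i + j + k)/2`; the first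
equation is norm one, and the other two give twice the bottom row of the image under `split`, with
`ν` replaced by its residue 2. -/
theorem exists_unit_coordinates : ∀ r₀ r₁ : ZMod 5, (r₀ ≠ 0 ∨ r₁ ≠ 0) →
    ∃ a ∈ ([-1, 0, 1] : List ℤ), ∃ b ∈ ([-1, 0, 1] : List ℤ), ∃ c ∈ ([-1, 0, 1] : List ℤ),
      ∃ d ∈ ([-2, -1, 0, 1, 2] : List ℤ),
        a * a + b * b + c * c + d * d + (a + b + c) * d = 1 ∧
        -(2 * (b : ZMod 5) + d) - 2 * d = 2 * r₀ ∧
        2 * (a : ZMod 5) + d - 2 * (2 * c + d) = 2 * r₁ := by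
  decide +kernel

theorem two_mul_cancel : ∀ x y : ZMod 5, 2 * x = 2 * y → x = y := by decide

/-- Hurwitz quaternions have integral doubled coordinates, so doubling allows the bottom row to be
reduced modulo 5 inside `ℤ_5`. -/
theorem two_mul_split_localMap (x : ℍ[ℚ]) {γ : Matrix (Fin 2) (Fin 2) ℤ_[5]}
    (h : split (localMap five x) = toQ γ) {A B C E : ℤ} (hA : 2 * x.re = A) (hB : 2 * x.imI = B)
    (hC : 2 * x.imJ = C) (hE : 2 * x.imK = E) :
    2 * bottomRow γ 0 = -(B : ZMod 5) - 2 * E ∧ 2 * bottomRow γ 1 = (A : ZMod 5) - 2 * C := by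
  have hc : ∀ {q : ℚ} {n : ℤ}, 2 * q = n → 2 * (q : ℚ_[5]) = n := fun h => by exact_mod_cast h
  have h0 : -(x.imI : ℚ_[5]) - x.imK * nuQ = γ 1 0 := congrFun (congrFun h 1) 0
  have h1 : (x.re : ℚ_[5]) - x.imJ * nuQ = γ 1 1 := congrFun (congrFun h 1) 1
  have h2 : ((2 : ℤ_[5]) : ℚ_[5]) = 2 := by
    have := PadicInt.coe_natCast (p := 5) 2
    exact_mod_cast this
  have e0 : 2 * γ 1 0 = -(B : ℤ_[5]) - E * nu := by
    refine PadicInt.ext ?_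
    push_cast
    rw [← h0, ← hc hB, ← hc hE, h2]
    ring
  have e1 : 2 * γ 1 1 = (A : ℤ_[5]) - C * nu := by
    refine PadicInt.ext ?_
    push_cast
    rw [← h1, ← hc hA, ← hc hC, h2]
    ring
  have e0' := congrArg red e0
  have e1' := congrArg red e1
  simp only [map_mul, map_sub, map_neg, map_intCast, red_nu, map_ofNat] at e0' e1'
  rw [bottomRow_eq]
  exact ⟨by simpa [mul_comm] using e0', by simpa [mul_comm] using e1'⟩

theorem star_mem_hurwitzOrder {x : ℍ[ℚ]} (hx : x ∈ hurwitzOrder) : star x ∈ hurwitzOrder := by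
  obtain ⟨a, b, c, d, rfl⟩ := hx
  exact ⟨a + d, -b, -c, -d, by ext <;> simp <;> ring⟩

theorem localUnit_mem {δ : (ℍ[ℚ])ˣ} (h : (δ : ℍ[ℚ]) ∈ hurwitzOrder)
    (hn : Quaternion.normSq (δ : ℍ[ℚ]) = 1) (p : Nat.Primes) : localUnit p δ ∈ localUnits p := by
  refine mem_localUnits_of_mul_eq_one (localMap_mem_hurwitz h p)
    (localMap_mem_hurwitz (star_mem_hurwitzOrder h) p) ?_
  rw [coe_localUnit, ← map_mul, Quaternion.self_mul_star, hn]
  simp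

/-- The unit group of the Hurwitz order acts transitively on the nonzero vectors modulo `5`. -/
theorem exists_unit_bottomRow (r : Fin 2 → ZMod 5) (hr : r ≠ 0) :
    ∃ δ : (ℍ[ℚ])ˣ, (∀ p, localUnit p δ ∈ localUnits p) ∧
      ∃ γ, split (localMap five δ) = toQ γ ∧ IsUnit γ ∧ bottomRow γ = r := by
  have hr' : r 0 ≠ 0 ∨ r 1 ≠ 0 := by
    by_contra! h
    exact hr (by ext i; fin_cases i; exacts [h.1, h.2])
  obtain ⟨a, -, b, -, c, -, d, -, hn, h0, h1⟩ := exists_unit_coordinates _ _ hr'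
  set x : ℍ[ℚ] := quat ((a : ℚ) + d / 2) ((b : ℚ) + d / 2) ((c : ℚ) + d / 2) ((d : ℚ) / 2) with hx
  have hxH : x ∈ hurwitzOrder := ⟨a, b, c, d, rfl⟩
  have hxn : Quaternion.normSq x = 1 := by
    rw [normSq_eq, hx]
    simp only [quat_re, quat_imI, quat_imJ, quat_imK]
    have : ((a * a + b * b + c * c + d * d + (a + b + c) * d : ℤ) : ℚ) = 1 := by rw [hn]; simp
    push_cast at this
    linear_combination this
  have hx0 : x ≠ 0 := Quaternion.normSq_ne_zero.mp (by rw [hxn]; exact one_ne_zero)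
  have hloc := fun p => localUnit_mem (δ := Units.mk0 x hx0) hxH hxn p
  obtain ⟨γ, hγ⟩ := mem_hurwitz_five_iff.mp (mem_localUnits.mp (hloc five)).1
  obtain ⟨γ', hγ'⟩ := mem_hurwitz_five_iff.mp (mem_localUnits.mp (hloc five)).2
  refine ⟨Units.mk0 x hx0, hloc, γ, hγ, ?_, ?_⟩
  · refine IsUnit.of_mul_eq_one γ' (toQ_injective ?_)
    rw [toQ_mul, ← hγ, ← hγ', ← map_mul, Units.mul_inv, map_one, toQ_one]
  · obtain ⟨e0, e1⟩ := two_mul_split_localMap x (A := 2 * a + d) (B := 2 * b + d) (C := 2 * c + d)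
      (E := d) hγ (by simp [hx]; ring) (by simp [hx]; ring) (by simp [hx]; ring)
      (by simp [hx]; ring)
    push_cast at e0 e1
    ext i
    fin_cases i
    · exact two_mul_cancel _ _ (e0.trans h0)
    · exact two_mul_cancel _ _ (e1.trans h1)

/-- `D_fˣ = Dˣ Γ̂₁(5)`. -/
theorem exists_decomposition (g : AdelicUnits) :
    ∃ δ u γ, InLevel Iw u γ ∧ g = diag δ * u := by
  obtain ⟨δ, hδ⟩ := exists_diag_mul_mem g
  set h := diag δ * g with hh
  obtain ⟨γ, hγ⟩ := mem_hurwitz_five_iff.mp (mem_localUnits.mp (hδ five)).1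
  obtain ⟨γ', hγ'⟩ := mem_hurwitz_five_iff.mp (mem_localUnits.mp (hδ five)).2
  have h1 : γ * γ' = 1 := toQ_injective <| by
    rw [toQ_mul, ← hγ, ← hγ', ← map_mul, Units.mul_inv, map_one, toQ_one]
  have h1' := mul_eq_one_comm.mp h1
  have hne : bottomRow γ' ≠ 0 := fun h0 => by
    have := bottomRow_mul γ' γ
    rw [h1', h0, Matrix.zero_vecMul, bottomRow_one] at this
    simpa using congrFun this 1
  -- `ε` is chosen with the same bottom row as `γ' = γ⁻¹`, so that `E γ` has bottom row that of `γ'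
  -- γ = 1`, namely `(0, 1)`.
  obtain ⟨ε, hε, E, hE, hEu, hEr⟩ := exists_unit_bottomRow _ hne
  refine ⟨(ε * δ)⁻¹, diag ε * h, E * γ, ⟨fun p _ => ?_, ?_, ?_⟩, ?_⟩
  · exact mul_mem (hε p) (hδ p)
  · refine mem_Iw_iff.mpr ⟨hEu.mul (IsUnit.of_mul_eq_one _ h1), ?_⟩
    rw [bottomRow_mul, hEr, ← bottomRow_mul, h1', bottomRow_one]
  · rw [RestrictedProduct.mul_apply, Units.val_mul, map_mul, hγ]
    exact (congrArg (· * toQ γ) hE).trans (toQ_mul _ _).symm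
  · rw [hh, ← mul_assoc, ← mul_assoc, ← map_mul, ← map_mul, mul_assoc, inv_mul_cancel, map_one,
      one_mul]

/-! ### Global elements that are integral at every prime. -/

theorem exists_int_of_forall_norm_le_one {q : ℚ} (h : ∀ p : Nat.Primes, ‖(q : ℚ_[(p : ℕ)])‖ ≤ 1) :
    ∃ n : ℤ, q = n := by
  by_cases hd : q.den = 1
  · exact ⟨q.num, (Rat.coe_int_num_of_den_eq_one hd).symm⟩
  · exfalso
    obtain ⟨p, hp, hpd⟩ := Nat.exists_prime_and_dvd hd
    have hfact : Fact p.Prime := ⟨hp⟩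
    have hcop : p.Coprime q.num.natAbs := (q.reduced.coprime_dvd_right hpd).symm
    have h1 : ‖(q.num : ℚ_[p])‖ = 1 := Padic.norm_intCast_eq_one_iff.mpr <| by
      rw [Int.isCoprime_iff_gcd_eq_one, Int.gcd_comm]; simpa [Int.gcd] using hcop
    have h2 : ‖(q.den : ℚ_[p])‖ < 1 := Padic.norm_natCast_lt_one_iff.mpr hpd
    have h3 : (q : ℚ_[p]) * q.den = q.num := by exact_mod_cast Rat.mul_den_eq_num q
    have h4 := congrArg norm h3
    rw [norm_mul, h1] at h4
    have h5 : ‖(q : ℚ_[p])‖ ≤ 1 := h ⟨p, hp⟩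
    nlinarith [norm_nonneg (q : ℚ_[p]), norm_nonneg (q.den : ℚ_[p])]

theorem mem_hurwitzOrder_of_forall {x : ℍ[ℚ]} (h : ∀ p, localMap p x ∈ hurwitz p) :
    x ∈ hurwitzOrder := by
  obtain ⟨a, ha⟩ := exists_int_of_forall_norm_le_one (q := x.re - x.imK) fun p => by
    push_cast; exact (mem_hurwitz_iff.mp (h p)).1
  obtain ⟨b, hb⟩ := exists_int_of_forall_norm_le_one (q := x.imI - x.imK) fun p => by
    push_cast; exact (mem_hurwitz_iff.mp (h p)).2.1
  obtain ⟨c, hc⟩ := exists_int_of_forall_norm_le_one (q := x.imJ - x.imK) fun p => by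
    push_cast; exact (mem_hurwitz_iff.mp (h p)).2.2.1
  obtain ⟨d, hd⟩ := exists_int_of_forall_norm_le_one (q := 2 * x.imK) fun p => by
    push_cast; exact (mem_hurwitz_iff.mp (h p)).2.2.2
  exact ⟨a, b, c, d, by ext <;> simp <;> linarith⟩

theorem exists_int_normSq {x : ℍ[ℚ]} (hx : x ∈ hurwitzOrder) :
    ∃ n : ℤ, Quaternion.normSq x = n := by
  obtain ⟨a, b, c, d, rfl⟩ := hx
  refine ⟨a * a + b * b + c * c + d * d + (a + b + c) * d, ?_⟩
  rw [normSq_eq]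
  push_cast
  simp only [quat_re, quat_imI, quat_imJ, quat_imK]
  ring

theorem normSq_eq_one_of_forall {δ : (ℍ[ℚ])ˣ} (h : ∀ p, localUnit p δ ∈ localUnits p) :
    Quaternion.normSq (δ : ℍ[ℚ]) = 1 := by
  obtain ⟨n, hn⟩ := exists_int_normSq (mem_hurwitzOrder_of_forall fun p => (h p).1)
  obtain ⟨m, hm⟩ := exists_int_normSq (x := ((δ⁻¹ : (ℍ[ℚ])ˣ) : ℍ[ℚ]))
    (mem_hurwitzOrder_of_forall fun p => (h p).2)
  have hnm : n * m = 1 := by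
    have : Quaternion.normSq (δ : ℍ[ℚ]) * Quaternion.normSq ((δ⁻¹ : (ℍ[ℚ])ˣ) : ℍ[ℚ]) = 1 := by
      rw [← map_mul, Units.mul_inv, map_one]
    rw [hn, hm] at this
    exact_mod_cast this
  have h0 : 0 ≤ n := by
    have : (0 : ℚ) ≤ n := hn ▸ Quaternion.normSq_nonneg
    exact_mod_cast this
  rw [hn, Int.eq_one_of_mul_eq_one_right h0 hnm, Int.cast_one]

/-- `Dˣ ∩ Γ̂₁(5) = 1`. -/
theorem eq_one_of_inLevel {δ : (ℍ[ℚ])ˣ} {γ : Matrix (Fin 2) (Fin 2) ℤ_[5]}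
    (h : InLevel Iw (diag δ) γ) : δ = 1 := by
  obtain ⟨γ', -, h'⟩ := h.exists_inv
  have hloc : ∀ p, localUnit p δ ∈ localUnits p := fun p => by
    by_cases hp : p = five
    · subst hp
      exact ⟨mem_hurwitz_five_iff.mpr ⟨γ, h.2.2⟩, mem_hurwitz_five_iff.mpr ⟨γ', h'.2.2⟩⟩
    · exact h.1 p hp
  have hn := normSq_eq_one_of_forall hloc
  obtain ⟨a, b, c, d, hx⟩ := mem_hurwitzOrder_of_forall fun p => (hloc p).1
  obtain ⟨e0, e1⟩ := two_mul_split_localMap (δ : ℍ[ℚ]) (A := 2 * a + d) (B := 2 * b + d)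
    (C := 2 * c + d) (E := d) h.2.2 (by simp [hx]; ring) (by simp [hx]; ring)
    (by simp [hx]; ring) (by simp [hx]; ring)
  rw [(mem_Iw_iff.mp h.2.1).2] at e0 e1
  have hN : (2 * a + d) ^ 2 + (2 * b + d) ^ 2 + (2 * c + d) ^ 2 + d ^ 2 = 4 := by
    rw [normSq_eq, hx] at hn
    simp only [quat_re, quat_imI, quat_imJ, quat_imK] at hn
    have : (((2 * a + d) ^ 2 + (2 * b + d) ^ 2 + (2 * c + d) ^ 2 + d ^ 2 : ℤ) : ℚ) = 4 := by
      push_cast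
      linear_combination 4 * hn
    exact_mod_cast this
  have hB : ((2 * b + d + 2 * d : ℤ) : ZMod 5) = 0 := by
    push_cast at e0 ⊢
    simp at e0
    linear_combination e0
  have hA : ((2 * a + d - 2 * (2 * c + d) - 2 : ℤ) : ZMod 5) = 0 := by
    push_cast at e1 ⊢
    simp at e1
    linear_combination -e1
  rw [ZMod.intCast_zmod_eq_zero_iff_dvd] at hA hB
  generalize hAA : 2 * a + d = A at *
  generalize hBB : 2 * b + d = B at *
  generalize hCC : 2 * c + d = C at *
  have hA1 : A ≤ 2 := by nlinarith
  have hA2 : -2 ≤ A := by nlinarith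
  have hB1 : B ≤ 2 := by nlinarith
  have hB2 : -2 ≤ B := by nlinarith
  have hC1 : C ≤ 2 := by nlinarith
  have hC2 : -2 ≤ C := by nlinarith
  have hd1 : d ≤ 2 := by nlinarith
  have hd2 : -2 ≤ d := by nlinarith
  -- Modulo 5, `B ≡ -2d` makes `B² + d²` divisible by 5, while it is at most 4.
  have hBd : B = 0 ∧ d = 0 := by
    have : B ^ 2 + d ^ 2 ≤ 4 := by nlinarith
    clear hAA hBB hCC hN hA e0 e1
    interval_cases B <;> interval_cases d <;> simp_all
  obtain ⟨rfl, rfl⟩ := hBd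
  -- Now `A² + C² = 4`, and substituting `A ≡ 2C + 2` forces `C ≡ 0` modulo 5.
  have hAC : A = 2 ∧ C = 0 := by
    clear hAA hBB hCC hB e0 e1
    interval_cases A <;> interval_cases C <;> simp_all
  obtain ⟨rfl, rfl⟩ := hAC
  obtain rfl : a = 1 := by lia
  obtain rfl : b = 0 := by lia
  obtain rfl : c = 0 := by lia
  ext <;> simp [hx]

/-- A vector `x` in a space with a right action of `Iw` is the value at `1` of an automorphic form
of level `Γ̂₁(5)`. -/
theorem exists_form {X : Type*} (act : Matrix (Fin 2) (Fin 2) ℤ_[5] → X → X) (x : X)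
    (hone : act 1 x = x)
    (hmul : ∀ γ ∈ Iw, ∀ γ' ∈ Iw, act (γ * γ') x = act γ' (act γ x)) :
    ∃ φ : AdelicUnits → X, φ 1 = x ∧ (∀ δ g, φ (diag δ * g) = φ g) ∧
      (∀ g u γ, InLevel Iw u γ → φ (g * u) = act γ (φ g)) ∧ ∀ g, ∃ γ ∈ Iw, φ g = act γ x := by
  choose δ u γ hu hg using exists_decomposition
  -- Since `Dˣ ∩ Γ̂₁(5) = 1`, the decomposition `g = δ u` is unique, so `g ↦ act γ x` does not
  -- depend on choices and the transformation laws follow by comparing decompositions.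
  have huniq : ∀ {ε ε' : (ℍ[ℚ])ˣ} {w w' : AdelicUnits} {η η' : Matrix (Fin 2) (Fin 2) ℤ_[5]},
      InLevel Iw w η → InLevel Iw w' η' → diag ε * w = diag ε' * w' → η = η' := by
    intro ε ε' w w' η η' hw hw' h
    obtain ⟨ζ, -, hζ⟩ := hw.exists_inv
    have h1 : diag (ε'⁻¹ * ε) = w' * w⁻¹ := by
      rw [map_mul, map_inv, eq_mul_inv_iff_mul_eq, mul_assoc, h, inv_mul_cancel_left]
    have h2 : ε'⁻¹ * ε = 1 := eq_one_of_inLevel (h1 ▸ hw'.mul hζ)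
    obtain rfl : ε' = ε := inv_mul_eq_one.mp h2
    obtain rfl : w = w' := mul_left_cancel h
    exact hw.unique hw'
  refine ⟨fun g => act (γ g) x, ?_, fun ε g => ?_, fun g w η hw => ?_,
    fun g => ⟨_, (hu g).2.1, rfl⟩⟩
  · have : γ 1 = 1 := huniq (ε := δ 1) (ε' := 1) (hu 1) InLevel.one (by rw [← hg]; simp)
    simp only [this, hone]
  · have : γ (diag ε * g) = γ g := huniq (ε := δ (diag ε * g)) (ε' := ε * δ g) (hu _) (hu _) (by
      rw [← hg, map_mul, mul_assoc, ← hg])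
    simp only [this]
  · have : γ (g * w) = γ g * η := huniq (ε := δ (g * w)) (ε' := δ g) (hu _) ((hu g).mul hw) (by
      rw [← hg, ← mul_assoc, ← hg])
    simp only [this]
    exact hmul _ (hu g).2.1 _ hw.2.1

/-! ### The weight `k` action of `M₂(ℚ_5)` on polynomials -/

/-- The action of `γ = (a b; c d)` on polynomials of degree at most `k - 2`:
`f ↦ ∑ f_i (a z + b)^i (c z + d)^(k - 2 - i)`. -/
noncomputable def polyAct (k : ℕ) (A : Matrix (Fin 2) (Fin 2) ℚ_[5]) :
    ℚ_[5][X] →ₗ[ℚ_[5]] ℚ_[5][X] :=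
  ∑ i ∈ Finset.range (k - 1), (LinearMap.toSpanSingleton ℚ_[5] ℚ_[5][X]
    ((C (A 0 0) * X + C (A 0 1)) ^ i * (C (A 1 0) * X + C (A 1 1)) ^ (k - 2 - i))).comp
      (lcoeff ℚ_[5] i)

variable {k : ℕ}

theorem polySlash_eq (γ : Matrix (Fin 2) (Fin 2) ℤ_[5]) : polySlash k γ = polyAct k (toQ γ) := rfl

theorem polyAct_apply (A : Matrix (Fin 2) (Fin 2) ℚ_[5]) (f : ℚ_[5][X]) :
    polyAct k A f = ∑ i ∈ Finset.range (k - 1), f.coeff i •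
      ((C (A 0 0) * X + C (A 0 1)) ^ i * (C (A 1 0) * X + C (A 1 1)) ^ (k - 2 - i)) := by
  simp [polyAct, LinearMap.sum_apply]

theorem natDegree_linear_pow_mul_le (a b c d : ℚ_[5]) (i j : ℕ) :
    ((C a * X + C b) ^ i * (C c * X + C d) ^ j).natDegree ≤ i + j := by
  refine natDegree_mul_le.trans (add_le_add ?_ ?_)
  · exact (natDegree_pow_le_of_le i natDegree_linear_le).trans (by simp)
  · exact (natDegree_pow_le_of_le j natDegree_linear_le).trans (by simp)

theorem polyAct_mem (A : Matrix (Fin 2) (Fin 2) ℚ_[5]) (f : ℚ_[5][X]) :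
    polyAct k A f ∈ degreeLT ℚ_[5] (k - 1) := by
  rw [polyAct_apply]
  refine Submodule.sum_mem _ fun i hi => Submodule.smul_mem _ _ ?_
  rw [Finset.mem_range] at hi
  rw [mem_degreeLT]
  refine (natDegree_le_iff_degree_le.mp (natDegree_linear_pow_mul_le _ _ _ _ _ _)).trans_lt ?_
  exact_mod_cast (by lia : i + (k - 2 - i) < k - 1)

theorem eval_polyAct (A : Matrix (Fin 2) (Fin 2) ℚ_[5]) {f : ℚ_[5][X]}
    (hf : f ∈ degreeLT ℚ_[5] (k - 1)) {z : ℚ_[5]} (hz : A 1 0 * z + A 1 1 ≠ 0) :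
    (polyAct k A f).eval z = (A 1 0 * z + A 1 1) ^ (k - 2) *
      f.eval ((A 0 0 * z + A 0 1) / (A 1 0 * z + A 1 1)) := by
  have hsum : f.eval ((A 0 0 * z + A 0 1) / (A 1 0 * z + A 1 1)) =
      ∑ i ∈ Finset.range (k - 1), f.coeff i *
        ((A 0 0 * z + A 0 1) / (A 1 0 * z + A 1 1)) ^ i := by
    by_cases hf0 : f = 0
    · simp [hf0]
    · exact eval_eq_sum_range' ((natDegree_lt_iff_degree_lt hf0).mpr (mem_degreeLT.mp hf)) _
  rw [polyAct_apply, hsum, eval_finsetSum, Finset.mul_sum]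
  refine Finset.sum_congr rfl fun i hi => ?_
  rw [Finset.mem_range] at hi
  have : (A 1 0 * z + A 1 1) ^ (k - 2) =
      (A 1 0 * z + A 1 1) ^ i * (A 1 0 * z + A 1 1) ^ (k - 2 - i) := by
    rw [← pow_add]; congr 1; lia
  simp only [smul_eq_mul, eval_smul, eval_mul, eval_pow, eval_add, eval_C, eval_X]
  rw [this, div_pow]
  generalize A 1 0 * z + A 1 1 = D at hz
  field_simp

theorem finite_setOf_linear_eq_zero {c d : ℚ_[5]} (h : c ≠ 0 ∨ d ≠ 0) :
    {z : ℚ_[5] | c * z + d = 0}.Finite := by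
  refine Set.Subsingleton.finite fun z hz w hw => ?_
  have h1 : c * (z - w) = 0 := by
    rw [Set.mem_ofPred_eq] at hz hw
    linear_combination hz - hw
  rcases mul_eq_zero.mp h1 with hc | hzw
  · subst hc
    rcases h with h | h
    · exact absurd rfl h
    · exact absurd (by simpa using hz) h
  · exact sub_eq_zero.mp hzw

theorem bottom_ne_zero (A : (Matrix (Fin 2) (Fin 2) ℚ_[5])ˣ) :
    (A : Matrix (Fin 2) (Fin 2) ℚ_[5]) 1 0 ≠ 0 ∨ (A : Matrix (Fin 2) (Fin 2) ℚ_[5]) 1 1 ≠ 0 := by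
  by_contra! h
  have := (Matrix.isUnit_iff_isUnit_det _).mp A.isUnit
  rw [Matrix.det_fin_two, h.1, h.2] at this
  simp at this

/-- Away from the finitely many zeros of the two denominators both sides are given by the fractional
linear formula, where the cocycle identity for `c z + d` applies; polynomials that agree at
infinitely many points are equal. -/
theorem polyAct_mul (A B : (Matrix (Fin 2) (Fin 2) ℚ_[5])ˣ) {f : ℚ_[5][X]}
    (hf : f ∈ degreeLT ℚ_[5] (k - 1)) :
    polyAct k (A * B : (Matrix (Fin 2) (Fin 2) ℚ_[5])ˣ) f = polyAct k B (polyAct k A f) := by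
  refine eq_of_infinite_eval_eq _ _ (Set.Infinite.mono ?_
    ((finite_setOf_linear_eq_zero (bottom_ne_zero B)).union
      (finite_setOf_linear_eq_zero (bottom_ne_zero (A * B)))).infinite_compl)
  intro z hz
  simp only [Set.mem_compl_iff, Set.mem_union, Set.mem_ofPred_eq, not_or] at hz ⊢
  obtain ⟨hB, hAB⟩ := hz
  rw [eval_polyAct _ hf hAB, eval_polyAct _ (polyAct_mem _ _) hB]
  simp only [Units.val_mul, Matrix.mul_apply, Fin.sum_univ_two] at hAB ⊢
  set a := (A : Matrix (Fin 2) (Fin 2) ℚ_[5])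
  set b := (B : Matrix (Fin 2) (Fin 2) ℚ_[5])
  have e1 : (a 1 0 * b 0 0 + a 1 1 * b 1 0) * z + (a 1 0 * b 0 1 + a 1 1 * b 1 1) =
      (b 1 0 * z + b 1 1) * (a 1 0 * ((b 0 0 * z + b 0 1) / (b 1 0 * z + b 1 1)) + a 1 1) := by
    field_simp
    ring
  have hA : a 1 0 * ((b 0 0 * z + b 0 1) / (b 1 0 * z + b 1 1)) + a 1 1 ≠ 0 := by
    rw [e1] at hAB
    exact right_ne_zero_of_mul hAB
  rw [eval_polyAct _ hf hA, e1, mul_pow, mul_assoc]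
  congr 3
  rw [div_eq_div_iff (mul_ne_zero hB hA) hA]
  field_simp
  ring

theorem polyAct_one {f : ℚ_[5][X]} (hf : f ∈ degreeLT ℚ_[5] (k - 1)) : polyAct k 1 f = f := by
  refine Polynomial.funext fun z => ?_
  rw [eval_polyAct _ hf (by simp)]
  simp

/-! ### The right action of `GL₂(ℚ_5)` on automorphic forms -/

/-- The element of `D_fˣ` with component `A` at `5` and `1` elsewhere. -/
noncomputable def at5 : (Matrix (Fin 2) (Fin 2) ℚ_[5])ˣ →* AdelicUnits where
  toFun A := RestrictedProduct.mulSingle localUnits five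
    (Units.map (split.symm : Matrix (Fin 2) (Fin 2) ℚ_[5] ≃+* ℍ[ℚ_[5]]).toMonoidHom A)
  map_one' := by rw [map_one]; exact RestrictedProduct.mulSingle_one localUnits five
  map_mul' A B := by rw [map_mul]; exact RestrictedProduct.mulSingle_mul localUnits five _ _

theorem split_at5 (A : (Matrix (Fin 2) (Fin 2) ℚ_[5])ˣ) :
    split (at5 A five : ℍ[ℚ_[5]]) = A := by
  have : at5 A five = Units.map
      (split.symm : Matrix (Fin 2) (Fin 2) ℚ_[5] ≃+* ℍ[ℚ_[5]]).toMonoidHom A :=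
    RestrictedProduct.mulSingle_eq_same localUnits five _
  rw [this]
  exact RingEquiv.apply_symm_apply _ _

theorem at5_apply_of_ne (A : (Matrix (Fin 2) (Fin 2) ℚ_[5])ˣ) {p : Nat.Primes} (hp : p ≠ five) :
    at5 A p = 1 :=
  RestrictedProduct.mulSingle_eq_of_ne localUnits _ hp

theorem commute_at5 (A : (Matrix (Fin 2) (Fin 2) ℚ_[5])ˣ) {u : AdelicUnits} (hu : u five = 1) :
    Commute (at5 A) u := by
  refine RestrictedProduct.ext _ _ fun p => ?_
  rw [RestrictedProduct.mul_apply, RestrictedProduct.mul_apply]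
  by_cases hp : p = five
  · subst hp
    rw [hu, mul_one, one_mul]
  · rw [at5_apply_of_ne A hp, mul_one, one_mul]

/-- The right action `(φ|A)(g) = φ(g A⁻¹) ||_k A` of `GL₂(ℚ_5)`. -/
noncomputable def formAct (k : ℕ) (A : (Matrix (Fin 2) (Fin 2) ℚ_[5])ˣ) :
    (AdelicUnits → ℚ_[5][X]) →ₗ[ℚ_[5]] (AdelicUnits → ℚ_[5][X]) where
  toFun φ g := polyAct k A (φ (g * (at5 A)⁻¹))
  map_add' φ ψ := by ext1 g; simp
  map_smul' c φ := by ext1 g; simp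

theorem formAct_apply (A : (Matrix (Fin 2) (Fin 2) ℚ_[5])ˣ) (φ : AdelicUnits → ℚ_[5][X])
    (g : AdelicUnits) : formAct k A φ g = polyAct k A (φ (g * (at5 A)⁻¹)) := rfl

/-- The polynomial valued functions on `Dˣ \ D_fˣ` that are invariant under the units of the
maximal order away from `5`. -/
structure IsForm (k : ℕ) (φ : AdelicUnits → ℚ_[5][X]) : Prop where
  mem (g) : φ g ∈ degreeLT ℚ_[5] (k - 1)
  left (δ : (ℍ[ℚ])ˣ) (g) : φ (diag δ * g) = φ g
  right (g u) : (∀ p ≠ five, u p ∈ localUnits p) → u five = 1 → φ (g * u) = φ g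

theorem IsForm.formAct {φ : AdelicUnits → ℚ_[5][X]} (h : IsForm k φ)
    (A : (Matrix (Fin 2) (Fin 2) ℚ_[5])ˣ) : IsForm k (formAct k A φ) where
  mem g := polyAct_mem _ _
  left δ g := by rw [formAct_apply, formAct_apply, mul_assoc, h.left]
  right g u hu hu5 := by
    rw [formAct_apply, formAct_apply, mul_assoc, ← map_inv, ← (commute_at5 A⁻¹ hu5).eq,
      ← mul_assoc, h.right _ _ hu hu5]

theorem formAct_mul (A B : (Matrix (Fin 2) (Fin 2) ℚ_[5])ˣ) {φ : AdelicUnits → ℚ_[5][X]}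
    (h : ∀ g, φ g ∈ degreeLT ℚ_[5] (k - 1)) :
    formAct k (A * B) φ = formAct k B (formAct k A φ) := by
  ext1 g
  rw [formAct_apply, formAct_apply, formAct_apply, polyAct_mul _ _ (h _), map_mul, mul_inv_rev,
    mul_assoc]

theorem IsForm.sum {ι : Type*} {s : Finset ι} {φ : ι → AdelicUnits → ℚ_[5][X]}
    (h : ∀ i ∈ s, IsForm k (φ i)) : IsForm k (∑ i ∈ s, φ i) where
  mem g := by
    rw [Finset.sum_apply]
    exact Submodule.sum_mem _ fun i hi => (h i hi).mem g
  left δ g := by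
    rw [Finset.sum_apply, Finset.sum_apply]
    exact Finset.sum_congr rfl fun i hi => (h i hi).left δ g
  right g u hu hu5 := by
    rw [Finset.sum_apply, Finset.sum_apply]
    exact Finset.sum_congr rfl fun i hi => (h i hi).right g u hu hu5

/-- The inclusion `GL₂(ℤ_5) → GL₂(ℚ_5)`. -/
noncomputable def unitQ : (Matrix (Fin 2) (Fin 2) ℤ_[5])ˣ →* (Matrix (Fin 2) (Fin 2) ℚ_[5])ˣ :=
  Units.map (PadicInt.Coe.ringHom (p := 5)).mapMatrix.toMonoidHom

@[simp] theorem coe_unitQ (w : (Matrix (Fin 2) (Fin 2) ℤ_[5])ˣ) :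
    (unitQ w : Matrix (Fin 2) (Fin 2) ℚ_[5]) = toQ w := rfl

theorem inLevel_at5 {K : Set (Matrix (Fin 2) (Fin 2) ℤ_[5])}
    {w : (Matrix (Fin 2) (Fin 2) ℤ_[5])ˣ} (hw : (w : Matrix (Fin 2) (Fin 2) ℤ_[5]) ∈ K) :
    InLevel K (at5 (unitQ w)) w :=
  ⟨fun p hp => by rw [at5_apply_of_ne _ hp]; exact one_mem _, hw, split_at5 _⟩

/-- Splitting `u` into its component at 5 and the rest separates the level condition into `IsForm`
and invariance under a `GL₂(ℚ_5)`-action. Traces and Hecke operators at 5 then become sums of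
translates. -/
theorem mem_classicalForms_iff {K : Set (Matrix (Fin 2) (Fin 2) ℤ_[5])}
    (hK : ∀ γ ∈ K, IsUnit γ) (hone : 1 ∈ K) {φ : AdelicUnits → ℚ_[5][X]} :
    φ ∈ classicalForms k K ↔ IsForm k φ ∧ ∀ w : (Matrix (Fin 2) (Fin 2) ℤ_[5])ˣ,
      (w : Matrix (Fin 2) (Fin 2) ℤ_[5]) ∈ K → formAct k (unitQ w) φ = φ := by
  constructor
  · rintro ⟨h₁, h₂, h₃⟩
    refine ⟨⟨h₁, h₂, fun g u hu hu5 => ?_⟩, fun w hw => ?_⟩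
    · rw [h₃ g u 1 ⟨hu, hone, by rw [hu5, Units.val_one, map_one]; exact toQ_one.symm⟩,
        polySlash_eq, toQ_one, polyAct_one (h₁ g)]
    · ext1 g
      rw [formAct_apply, coe_unitQ, ← polySlash_eq, ← h₃ _ _ _ (inLevel_at5 hw),
        inv_mul_cancel_right]
  · rintro ⟨h, h'⟩
    refine ⟨h.mem, h.left, fun g u γ hu => ?_⟩
    obtain ⟨w, rfl⟩ := hK γ hu.2.1
    have h1 : φ (g * u) = φ (g * (u * (at5 (unitQ w))⁻¹) * at5 (unitQ w)) := by
      rw [mul_assoc, inv_mul_cancel_right]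
    rw [h1, ← h' w hu.2.1, formAct_apply, mul_inv_cancel_right, h' w hu.2.1, h.right]
    · rfl
    · intro p hp
      rw [RestrictedProduct.mul_apply, RestrictedProduct.inv_apply, at5_apply_of_ne _ hp, inv_one,
        mul_one]
      exact hu.1 p hp
    · rw [RestrictedProduct.mul_apply, RestrictedProduct.inv_apply, mul_inv_eq_one]
      refine Units.ext (split.injective ?_)
      rw [split_at5, hu.2.2]
      rfl

end HeckeFive

namespace HeckeFive

variable {k : ℕ}

/-! ### The operator `U₂` -/

/-- The inverse is the conjugate divided by `p`, and `p` is a unit at `q`. -/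
theorem localUnit_mem_of_normSq {p q : Nat.Primes} (hq : q ≠ p) {δ : (ℍ[ℚ])ˣ}
    (h : (δ : ℍ[ℚ]) ∈ hurwitzOrder) (hn : Quaternion.normSq (δ : ℍ[ℚ]) = ((p : ℕ) : ℚ)) :
    localUnit q δ ∈ localUnits q := by
  obtain ⟨t, ht, hpt⟩ := exists_pow_mul_eq_one hq 1
  refine mem_localUnits_of_mul_eq_one (y := localMap q (star (δ : ℍ[ℚ])) * t)
    (localMap_mem_hurwitz h q)
    (mul_mem (localMap_mem_hurwitz (star_mem_hurwitzOrder h) q) ht) ?_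
  rw [coe_localUnit, ← mul_assoc, ← map_mul, Quaternion.self_mul_star, hn]
  rw [pow_one] at hpt
  have : localMap q (algebraMap ℚ ℍ[ℚ] ((p : ℕ) : ℚ)) = ((p : ℕ) : ℍ[ℚ_[(q : ℕ)]]) := by
    rw [map_natCast, map_natCast]
  exact (congrArg (· * t) this).trans hpt

theorem coeff_polyAct_of_diagonal {A : Matrix (Fin 2) (Fin 2) ℚ_[5]} (h₁ : A 0 1 = 0)
    (h₂ : A 1 0 = 0) {f : ℚ_[5][X]} (hf : f ∈ degreeLT ℚ_[5] (k - 1)) (m : ℕ) :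
    (polyAct k A f).coeff m = f.coeff m * (A 0 0 ^ m * A 1 1 ^ (k - 2 - m)) := by
  rw [polyAct_apply, finsetSum_coeff]
  have key : ∀ i, (f.coeff i • ((C (A 0 0) * X + C (A 0 1)) ^ i *
      (C (A 1 0) * X + C (A 1 1)) ^ (k - 2 - i))).coeff m =
      if m = i then f.coeff m * (A 0 0 ^ m * A 1 1 ^ (k - 2 - m)) else 0 := fun i => by
    have : (C (A 0 0) * X + C (A 0 1)) ^ i * (C (A 1 0) * X + C (A 1 1)) ^ (k - 2 - i) =
        C (A 0 0 ^ i * A 1 1 ^ (k - 2 - i)) * X ^ i := by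
      rw [h₁, h₂]
      simp only [C_0, add_zero, zero_mul, zero_add, C_mul, C_pow]
      ring
    rw [this, coeff_smul, coeff_C_mul_X_pow]
    split_ifs with h
    · rw [h, smul_eq_mul]
    · simp
  simp only [key]
  rw [Finset.sum_ite_eq]
  split_ifs with h
  · rfl
  · rw [Finset.mem_range, not_lt] at h
    have : f.coeff m = 0 := coeff_eq_zero_of_degree_lt <|
      (mem_degreeLT.mp hf).trans_le (by exact_mod_cast h)
    rw [this, zero_mul]

/-! ### Classical forms of level `Γ̂₁(5)` as polynomials. -/

theorem classicalForms_apply {φ : AdelicUnits → ℚ_[5][X]} (h : φ ∈ classicalForms k Iw)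
    {δ : (ℍ[ℚ])ˣ} {u : AdelicUnits} {γ : Matrix (Fin 2) (Fin 2) ℤ_[5]} (hu : InLevel Iw u γ) :
    φ (diag δ * u) = polyAct k (toQ γ) (φ 1) := by
  rw [h.2.1, ← one_mul u, h.2.2 1 u γ hu, polySlash_eq]

theorem classicalForms_ext {φ ψ : AdelicUnits → ℚ_[5][X]} (h : φ ∈ classicalForms k Iw)
    (h' : ψ ∈ classicalForms k Iw) (h1 : φ 1 = ψ 1) : φ = ψ := by
  ext1 g
  obtain ⟨δ, u, γ, hu, rfl⟩ := exists_decomposition g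
  rw [classicalForms_apply h hu, classicalForms_apply h' hu, h1]

theorem isUnit_of_mem_Iw {γ : Matrix (Fin 2) (Fin 2) ℤ_[5]} (h : γ ∈ Iw) : IsUnit γ :=
  (mem_Iw_iff.mp h).1

theorem exists_classicalForm {f : ℚ_[5][X]} (hf : f ∈ degreeLT ℚ_[5] (k - 1)) :
    ∃ φ ∈ classicalForms k Iw, φ 1 = f := by
  obtain ⟨φ, h1, hl, hr, hv⟩ := exists_form (fun γ => polyAct k (toQ γ)) f
    (by rw [toQ_one]; exact polyAct_one hf) (fun γ hγ γ' hγ' => by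
      obtain ⟨w, rfl⟩ := isUnit_of_mem_Iw hγ
      obtain ⟨w', rfl⟩ := isUnit_of_mem_Iw hγ'
      rw [← Units.val_mul, ← coe_unitQ, map_mul, polyAct_mul _ _ hf]
      rfl)
  refine ⟨φ, ⟨fun g => ?_, hl, hr⟩, h1⟩
  obtain ⟨γ, -, h⟩ := hv g
  rw [h]
  exact polyAct_mem _ _

/-- `y2` as an element of `ℤ_2`. -/
noncomputable def y2Int : ℤ_[2] := exists_root_two.choose

theorem coe_y2Int : (y2Int : ℚ_[2]) = y2 := rfl

/-- `D ⊗ ℚ_2` is a division algebra, so its maximal order is unique and stable under conjugation.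
The witnesses are the explicit coordinates of the conjugate, simplified by `y² + y + 2 = 0`. This is
why `U₂` preserves the level. -/
theorem pi2_conj_mem {x : ℍ[ℚ_[2]]} (hx : x ∈ hurwitz two) :
    ((pi2Unit⁻¹ : (ℍ[ℚ_[2]])ˣ) : ℍ[ℚ_[2]]) * x * pi2 ∈ hurwitz two := by
  obtain ⟨a, b, c, d, rfl⟩ := hx
  have h : y2 * y2 + y2 + 2 = 0 := y2_spec
  refine ⟨a + d - (b + y2Int * c) * (1 + y2Int),
    -b - (b + y2Int * c) - (b + y2Int * c) * (1 + y2Int),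
    -c - (b + y2Int * c) * y2Int - (b + y2Int * c) * (1 + y2Int),
    -d + (b + y2Int * c) * (1 + y2Int) + (b + y2Int * c) * (1 + y2Int), ?_⟩
  change quat 0 (1 / 2) (y2 / 2) (-(1 + y2) / 2) * _ * quat 0 1 y2 (-(1 + y2)) = _
  push_cast
  rw [coe_y2Int]
  generalize (a : ℚ_[2]) = a
  generalize (b : ℚ_[2]) = b
  generalize (c : ℚ_[2]) = c
  generalize (d : ℚ_[2]) = d
  ext <;> simp
  · linear_combination -(a + d / 2) * h
  · linear_combination (b + d / 2) * h
  · linear_combination (c + d / 2) * h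
  · linear_combination (d / 2) * h

theorem pi2_conj_mem_localUnits {x : (ℍ[ℚ_[2]])ˣ} (hx : x ∈ localUnits two) :
    pi2Unit⁻¹ * x * pi2Unit ∈ localUnits two := by
  refine mem_localUnits_of_mul_eq_one (p := two)
    (y := ((pi2Unit⁻¹ * x⁻¹ * pi2Unit : (ℍ[ℚ_[2]])ˣ) : ℍ[ℚ_[2]])) ?_ ?_ ?_
  · exact pi2_conj_mem hx.1
  · exact pi2_conj_mem hx.2
  · rw [← Units.val_mul]
    simp [mul_assoc]

theorem pi2Adele_two : pi2Adele two = pi2Unit :=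
  RestrictedProduct.mulSingle_eq_same localUnits two _

theorem pi2Adele_of_ne {p : Nat.Primes} (hp : p ≠ two) : pi2Adele p = 1 :=
  RestrictedProduct.mulSingle_eq_of_ne localUnits _ hp

theorem five_ne_two : five ≠ two := fun h => by
  have := congrArg (fun p : Nat.Primes => (p : ℕ)) h
  norm_num at this

theorem U2_apply (φ : AdelicUnits → ℚ_[5][X]) (g : AdelicUnits) : U2 φ g = φ (g * pi2Adele) := rfl

theorem inLevel_pi2_conj {K : Set (Matrix (Fin 2) (Fin 2) ℤ_[5])} {u : AdelicUnits}
    {γ : Matrix (Fin 2) (Fin 2) ℤ_[5]} (hu : InLevel K u γ) :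
    InLevel K (pi2Adele⁻¹ * u * pi2Adele) γ := by
  refine ⟨fun p hp => ?_, hu.2.1, ?_⟩
  · rw [RestrictedProduct.mul_apply, RestrictedProduct.mul_apply, RestrictedProduct.inv_apply]
    by_cases h2 : p = two
    · subst h2
      rw [pi2Adele_two]
      exact pi2_conj_mem_localUnits (hu.1 two hp)
    · rw [pi2Adele_of_ne h2, inv_one, one_mul, mul_one]
      exact hu.1 p hp
  · rw [RestrictedProduct.mul_apply, RestrictedProduct.mul_apply, RestrictedProduct.inv_apply,
      pi2Adele_of_ne five_ne_two, inv_one, one_mul, mul_one]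
    exact hu.2.2

theorem U2_mem {K : Set (Matrix (Fin 2) (Fin 2) ℤ_[5])} {φ : AdelicUnits → ℚ_[5][X]}
    (h : φ ∈ classicalForms k K) : U2 φ ∈ classicalForms k K := by
  refine ⟨fun g => h.1 _, fun δ g => ?_, fun g u γ hu => ?_⟩
  · rw [U2_apply, U2_apply, mul_assoc, h.2.1]
  · rw [U2_apply, U2_apply, ← h.2.2 _ _ _ (inLevel_pi2_conj hu)]
    congr 1
    group

theorem isUnit_two : IsUnit (2 : ℤ_[5]) := by
  rw [← red_ne_zero_iff, map_ofNat]
  decide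

theorem coe_padicInt_two : ((2 : ℤ_[5]) : ℚ_[5]) = 2 := by
  have := PadicInt.coe_natCast (p := 5) 2
  exact_mod_cast this

/-- `π₂ ∈ Dˣ Γ̂₁(5)`, with explicit component at `5`. -/
theorem exists_decomposition_pi2 : ∃ δ u γ, InLevel Iw u γ ∧ pi2Adele = diag δ * u ∧
    toQ γ = !![(nuQ - 1) / 2, 0; 0, -(1 + nuQ) / 2] := by
  -- The global element is `-1 - j`, of norm 2. It agrees with `π₂` up to a unit at 2, and the
  -- inverse of its image at 5 is diagonal with lower right entry `-(1 + ν)/2 ≡ 1` modulo 5.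
  have hx : quat (-1 : ℚ) 0 (-1) 0 ∈ hurwitzOrder := by
    simpa using quat_intCast_mem (-1) 0 (-1) 0
  have hn : Quaternion.normSq (quat (-1 : ℚ) 0 (-1) 0) = 2 := by
    rw [normSq_eq]; norm_num
  have hx0 : quat (-1 : ℚ) 0 (-1) 0 ≠ 0 :=
    Quaternion.normSq_ne_zero.mp (by rw [hn]; norm_num)
  obtain ⟨h, hh⟩ := isUnit_two.exists_right_inv
  have hh' : (h : ℚ_[5]) = 1 / 2 := by
    have := congrArg (fun x : ℤ_[5] => (x : ℚ_[5])) hh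
    simp only [PadicInt.coe_mul, coe_padicInt_two, PadicInt.coe_one] at this
    rw [eq_div_iff two_ne_zero, mul_comm, this]
  have hred : red h = 3 := by
    have := congrArg red hh
    rw [map_mul, map_one, map_ofNat] at this
    revert this
    generalize red h = y
    revert y
    decide
  set δ := Units.mk0 _ hx0 with hδ
  refine ⟨δ, (diag δ)⁻¹ * pi2Adele, !![h * (nu - 1), 0; 0, -(h * (1 + nu))],
    ⟨fun p hp => ?_, ?_, ?_⟩,
    (mul_inv_cancel_left _ _).symm, ?_⟩
  · rw [RestrictedProduct.mul_apply, RestrictedProduct.inv_apply, diag_apply]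
    by_cases h2 : p = two
    · subst h2
      rw [pi2Adele_two]
      have e₁ : (((localUnit two δ)⁻¹ * pi2Unit : (ℍ[ℚ_[2]])ˣ) : ℍ[ℚ_[2]]) =
          quat (-(y2 / 2)) (-(2 + y2) / 2) (-(y2 / 2)) (y2 / 2) := by
        rw [Units.val_mul, Units.inv_mul_eq_iff_eq_mul, coe_localUnit, hδ, Units.val_mk0,
          localMap_apply]
        change pi2 = _
        ext <;> simp [pi2] <;> ring
      refine mem_localUnits_of_mul_eq_one (p := two)
        (y := quat (y2 / 2) (-(2 + y2) / 2) (-(y2 / 2)) (y2 / 2)) ?_ ?_ ?_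
      · rw [e₁]
        refine ⟨-y2Int, -1 - y2Int, -y2Int, y2Int, ?_⟩
        push_cast
        rw [coe_y2Int]
        ext <;> simp <;> ring
      · refine ⟨0, -1 - y2Int, -y2Int, y2Int, ?_⟩
        push_cast
        rw [coe_y2Int]
        ext <;> simp <;> ring
      · rw [e₁]
        have h := y2_spec
        ext <;> simp
        · linear_combination -h
        all_goals ring
    · rw [pi2Adele_of_ne h2, mul_one]
      exact inv_mem (localUnit_mem_of_normSq h2 hx (by rw [hδ, Units.val_mk0, hn]; norm_num))
  · rw [mem_Iw_iff, Matrix.isUnit_iff_isUnit_det, ← red_ne_zero_iff, Matrix.det_fin_two,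
      bottomRow_eq]
    simp [hred]
    decide
  · rw [RestrictedProduct.mul_apply, RestrictedProduct.inv_apply, diag_apply,
      pi2Adele_of_ne five_ne_two, mul_one]
    have h1 : split (localUnit five δ : ℍ[ℚ_[5]]) = !![-1 - nuQ, 0; 0, -1 + nuQ] := by
      rw [coe_localUnit, hδ, Units.val_mk0, localMap_apply]
      ext i j
      fin_cases i <;> fin_cases j <;> simp [split]
      ring
    have h2 : split (((localUnit five δ)⁻¹ : (ℍ[ℚ_[5]])ˣ) : ℍ[ℚ_[5]]) *
        split (localUnit five δ : ℍ[ℚ_[5]]) = 1 := by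
      rw [← map_mul, Units.inv_mul, map_one]
    refine left_inv_eq_right_inv h2 ?_
    rw [h1]
    have hv := nuQ_mul_nuQ
    ext i j
    fin_cases i <;> fin_cases j <;> simp [Matrix.mul_apply, Fin.sum_univ_two, hh']
    · linear_combination (-1 / 2) * hv
    · linear_combination (-1 / 2) * hv
  · ext i j
    fin_cases i <;> fin_cases j <;> simp [hh'] <;> ring

/-- The nonzero coefficients of `f` are in degrees congruent to `a` modulo `4`. -/
def SupportedOn (a : ℕ) (f : ℚ_[5][X]) : Prop := ∀ m, f.coeff m ≠ 0 → m % 4 = a % 4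

/-- The congruence conditions on the weight and the index. -/
def Admissible (k a : ℕ) : Prop := (k % 4 = 2 ∧ a % 2 = 0) ∨ (k % 4 = 0 ∧ a % 2 = 1)

theorem nuQ_pow_four : nuQ ^ 4 = 1 := by
  have := nuQ_mul_nuQ
  linear_combination (nuQ ^ 2 - 1) * this

/-- `-ν` is a fourth root of unity whose residue `-2` generates `𝔽_5ˣ`, so it has order exactly 4.
-/
theorem neg_nuQ_pow_eq_iff (m a : ℕ) : (-nuQ) ^ m = (-nuQ) ^ a ↔ m % 4 = a % 4 := by
  constructor
  · intro h
    have h1 : (-nu) ^ m = (-nu) ^ a := PadicInt.ext (by push_cast; exact h)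
    have h2 := congrArg red h1
    rw [map_pow, map_pow, map_neg, red_nu] at h2
    have h3 : ∀ n, (-2 : ZMod 5) ^ n = (-2) ^ (n % 4) := fun n => by
      conv_lhs => rw [← Nat.div_add_mod n 4, pow_add, pow_mul]
      rw [show (-2 : ZMod 5) ^ 4 = 1 by decide, one_pow, one_mul]
    rw [h3 m, h3 a] at h2
    have hm := Nat.mod_lt m (show 4 > 0 by norm_num)
    have ha := Nat.mod_lt a (show 4 > 0 by norm_num)
    generalize m % 4 = m at *
    generalize a % 4 = a at *
    clear h1 h
    revert h2
    interval_cases m <;> interval_cases a <;> decide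
  · intro h
    have h3 : ∀ n, (-nuQ) ^ n = (-nuQ) ^ (n % 4) := fun n => by
      conv_lhs => rw [← Nat.div_add_mod n 4, pow_add, pow_mul]
      rw [neg_pow, nuQ_pow_four]
      norm_num
    rw [h3 m, h3 a, h]

/-- On values at 1, `U₂` acts through the diagonal matrix of `exists_decomposition_pi2`. Its entries
have ratio `-ν`, and evenness of `k - 2` absorbs the sign of `-(1 + ν)/2`. -/
theorem coeff_U2 {φ : AdelicUnits → ℚ_[5][X]} (hk : Even k) (h : φ ∈ classicalForms k Iw) (m : ℕ) :
    (U2 φ 1).coeff m = (φ 1).coeff m * (((1 + nuQ) / 2) ^ ((k : ℤ) - 2) * (-nuQ) ^ m) := by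
  obtain ⟨δ, u, γ, hu, hg, hγ⟩ := exists_decomposition_pi2
  rw [U2_apply, one_mul, hg, classicalForms_apply h hu, hγ,
    coeff_polyAct_of_diagonal rfl rfl (h.1 1)]
  by_cases h0 : (φ 1).coeff m = 0
  · rw [h0, zero_mul, zero_mul]
  congr 1
  have hm : m < k - 1 := by
    by_contra hm
    exact h0 (coeff_eq_zero_of_degree_lt <| (mem_degreeLT.mp (h.1 1)).trans_le
      (by exact_mod_cast not_lt.mp hm))
  have e : (k : ℤ) - 2 = ((k - 2 : ℕ) : ℤ) := by lia
  have hev : Even (k - 2) := hk.tsub even_two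
  rw [e, zpow_natCast]
  simp only [Matrix.of_apply, Matrix.cons_val_zero, Matrix.cons_val_one]
  have e1 : (nuQ - 1) / 2 = (-(1 + nuQ) / 2) * (-nuQ) := by
    linear_combination (-1 / 2) * nuQ_mul_nuQ
  have e2 : (-(1 + nuQ) / 2) ^ (k - 2) = ((1 + nuQ) / 2) ^ (k - 2) := by
    rw [neg_div, hev.neg_pow]
  rw [e1, mul_pow, mul_right_comm, ← pow_add, show m + (k - 2 - m) = k - 2 by lia, e2]

theorem one_add_nuQ_ne_zero : (1 + nuQ) / 2 ≠ 0 := fun h => by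
  have h1 : nuQ = -1 := by
    rw [div_eq_zero_iff] at h
    rcases h with h | h
    · linear_combination h
    · exact absurd h two_ne_zero
  have := nuQ_mul_nuQ
  rw [h1] at this
  norm_num at this

/-- `U₂` is diagonal in the monomials, and its eigenvalues separate exactly the residues of the
degree modulo 4. -/
theorem mem_classicalFormsPart_iff {a : ℕ} {φ : AdelicUnits → ℚ_[5][X]} (hk : Even k)
    (h : φ ∈ classicalForms k Iw) : φ ∈ classicalFormsPart k a Iw ↔ SupportedOn a (φ 1) := by
  have h1 : φ ∈ classicalFormsPart k a Iw ↔
      U2 φ = (((1 + nuQ) / 2) ^ ((k : ℤ) - 2) * (-nuQ) ^ a) • φ := by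
    rw [classicalFormsPart, Submodule.mem_inf, Module.End.mem_eigenspace_iff]
    exact and_iff_right h
  rw [h1]
  constructor
  · intro h2 m hm
    have h3 := coeff_U2 hk h m
    rw [h2, Pi.smul_apply, coeff_smul, smul_eq_mul, mul_comm] at h3
    exact (neg_nuQ_pow_eq_iff m a).mp
      (mul_left_cancel₀ (zpow_ne_zero _ one_add_nuQ_ne_zero) (mul_left_cancel₀ hm h3)).symm
  · intro h2
    refine classicalForms_ext (U2_mem h) (Submodule.smul_mem _ _ h) ?_
    ext m
    rw [coeff_U2 hk h m, Pi.smul_apply, coeff_smul, smul_eq_mul]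
    by_cases hm : (φ 1).coeff m = 0
    · rw [hm, mul_zero, zero_mul]
    · rw [(neg_nuQ_pow_eq_iff m a).mpr (h2 m hm), mul_comm]

end HeckeFive

namespace HeckeFive

variable {k a : ℕ}

/-! ### Level `Γ₀(5)` -/

/-- The Iwahori subgroup of `GL₂(ℤ_5)`. -/
def Iw0 : Set (Matrix (Fin 2) (Fin 2) ℤ_[5]) := {γ | IsUnit γ ∧ bottomRow γ 0 = 0}

/-- The matrix of `j` multiplies `z^m` by `ν^(k-2) (-1)^(k-2-m)`, and admissibility makes this 1 for
`m ≡ a` modulo 4. -/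
theorem polyAct_diag_nu (hk : Admissible k a) {f : ℚ_[5][X]} (hf : f ∈ degreeLT ℚ_[5] (k - 1))
    (hs : SupportedOn a f) : polyAct k !![nuQ, 0; 0, -nuQ] f = f := by
  ext m
  rw [coeff_polyAct_of_diagonal rfl rfl hf]
  by_cases h0 : f.coeff m = 0
  · rw [h0, zero_mul]
  have hm : m < k - 1 := by
    by_contra hm
    exact h0 (coeff_eq_zero_of_degree_lt <| (mem_degreeLT.mp hf).trans_le
      (by exact_mod_cast not_lt.mp hm))
  have hma := hs m h0
  simp only [Matrix.of_apply, Matrix.cons_val_zero, Matrix.cons_val_one]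
  have h4 : ∀ n r : ℕ, nuQ ^ (4 * n + r) = nuQ ^ r := fun n r => by
    rw [pow_add, pow_mul, nuQ_pow_four, one_pow, one_mul]
  have h2 : nuQ ^ 2 = -1 := by rw [pow_two, nuQ_mul_nuQ]
  have e : nuQ ^ m * (-nuQ) ^ (k - 2 - m) = nuQ ^ (k - 2) * (-1) ^ (k - 2 - m) := by
    rw [neg_pow, mul_left_comm, ← pow_add, mul_comm]
    congr 2
    lia
  rw [e]
  rcases hk with ⟨hk, ha⟩ | ⟨hk, ha⟩
  · have h1 : k - 2 = 4 * ((k - 2) / 4) + 0 := by lia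
    have h3 : Even (k - 2 - m) := by rw [Nat.even_iff]; lia
    rw [h3.neg_one_pow, h1, h4, pow_zero, mul_one, mul_one]
  · have h1 : k - 2 = 4 * ((k - 2) / 4) + 2 := by lia
    have h3 : Odd (k - 2 - m) := by rw [Nat.odd_iff]; lia
    rw [h3.neg_one_pow, h1, h4, h2]
    ring

/-- The quaternion `j`. -/
def quatJ : (ℍ[ℚ])ˣ where
  val := quat 0 0 1 0
  inv := quat 0 0 (-1) 0
  val_inv := by ext <;> simp
  inv_val := by ext <;> simp

theorem quatJ_mem (p : Nat.Primes) : localUnit p quatJ ∈ localUnits p := by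
  refine localUnit_mem ?_ ?_ p
  · change quat 0 0 1 0 ∈ hurwitzOrder
    simpa using quat_intCast_mem 0 0 1 0
  · rw [normSq_eq]
    simp [quatJ]

theorem split_quatJ : split (localMap five quatJ) = !![nuQ, 0; 0, -nuQ] := by
  rw [localMap_apply]
  ext i j
  fin_cases i <;> fin_cases j <;> simp [split, quatJ]

/-- The image of `j` in `GL₂(ℤ_5)`. -/
noncomputable def matrixJ : (Matrix (Fin 2) (Fin 2) ℤ_[5])ˣ where
  val := !![nu, 0; 0, -nu]
  inv := !![-nu, 0; 0, nu]
  val_inv := by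
    have h := nu_mul_nu
    ext1 i j
    fin_cases i <;> fin_cases j <;> simp [Matrix.mul_apply, Fin.sum_univ_two, h]
  inv_val := by
    have h := nu_mul_nu
    ext1 i j
    fin_cases i <;> fin_cases j <;> simp [Matrix.mul_apply, Fin.sum_univ_two, h]

theorem toQ_matrixJ : toQ matrixJ = !![nuQ, 0; 0, -nuQ] := by
  ext i j
  fin_cases i <;> fin_cases j <;> simp [matrixJ]

theorem even_of_admissible (hk : Admissible k a) : Even k := by
  rw [Nat.even_iff]
  rcases hk with h | h <;> lia

theorem supportedOn_of_mem (hk : Admissible k a) {φ : AdelicUnits → ℚ_[5][X]}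
    (h : φ ∈ classicalFormsPart k a Iw) : SupportedOn a (φ 1) :=
  (mem_classicalFormsPart_iff (even_of_admissible hk) h.1).mp h

/-- Left multiplication by `j` changes neither `φ` nor `φ 1`, and multiplies the bottom row modulo 5
by `-2`, a generator of `𝔽_5ˣ`. A suitable power of `j` thus moves an Iwahori element into `Γ̂₁(5)`.
-/
theorem apply_of_inLevel_Iw0 (hk : Admissible k a) {φ : AdelicUnits → ℚ_[5][X]}
    (h : φ ∈ classicalFormsPart k a Iw) {u : AdelicUnits} {w : (Matrix (Fin 2) (Fin 2) ℤ_[5])ˣ}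
    (hu : InLevel Iw0 u w) : φ u = polyAct k (toQ w) (φ 1) := by
  have key : ∀ (n : ℕ) (u : AdelicUnits) (w : (Matrix (Fin 2) (Fin 2) ℤ_[5])ˣ), InLevel Iw0 u w →
      bottomRow w 1 * (-2) ^ n = 1 → φ u = polyAct k (toQ w) (φ 1) := by
    intro n
    induction n with
    | zero =>
      intro u w hu hw
      rw [pow_zero, mul_one] at hw
      have hIw : InLevel Iw u w := ⟨hu.1, mem_Iw_iff.mpr ⟨w.isUnit, by
        ext i
        fin_cases i
        exacts [hu.2.1.2, hw]⟩, hu.2.2⟩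
      simpa using classicalForms_apply h.1 (δ := 1) hIw
    | succ n ih =>
      intro u w hu hw
      have hrow : bottomRow ((matrixJ * w : (Matrix (Fin 2) (Fin 2) ℤ_[5])ˣ) :
          Matrix (Fin 2) (Fin 2) ℤ_[5]) = (-2 : ZMod 5) • bottomRow w := by
        rw [bottomRow_eq, bottomRow_eq]
        ext i
        fin_cases i <;> simp [matrixJ, Matrix.mul_apply, Fin.sum_univ_two]
      have := ih (diag quatJ * u) (matrixJ * w) ⟨fun p hp => mul_mem (quatJ_mem p) (hu.1 p hp),
        ⟨(matrixJ * w).isUnit, by rw [hrow, Pi.smul_apply, hu.2.1.2, smul_zero]⟩, by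
          rw [RestrictedProduct.mul_apply, Units.val_mul, map_mul, hu.2.2]
          exact (congrArg (· * toQ w) (split_quatJ.trans toQ_matrixJ.symm)).trans
            (toQ_mul _ _).symm⟩ (by
          rw [hrow, Pi.smul_apply, smul_eq_mul, ← hw]; ring)
      rw [h.1.2.1, ← coe_unitQ, map_mul, polyAct_mul _ _ (h.1.1 1), coe_unitQ, coe_unitQ,
        toQ_matrixJ,
        polyAct_diag_nu hk (h.1.1 1) (supportedOn_of_mem hk h)] at this
      exact this
  have hne : bottomRow w 1 ≠ 0 := fun h0 => by
    have h1 := bottomRow_mul w (w⁻¹ : (Matrix (Fin 2) (Fin 2) ℤ_[5])ˣ)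
    have h2 : bottomRow w = 0 := by
      ext i
      fin_cases i
      exacts [hu.2.1.2, h0]
    rw [h2, Matrix.zero_vecMul, Units.mul_inv, bottomRow_one] at h1
    simpa using congrFun h1 1
  have hpow : ∀ x : ZMod 5, x ≠ 0 → ∃ n < 4, x * (-2) ^ n = 1 := by decide
  obtain ⟨n, -, hn⟩ := hpow _ hne
  exact key n u w hu hn

theorem isForm_of_mem {φ : AdelicUnits → ℚ_[5][X]} (h : φ ∈ classicalForms k Iw) : IsForm k φ :=
  ((mem_classicalForms_iff (fun _ => isUnit_of_mem_Iw) one_mem_Iw).mp h).1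

theorem formAct_of_mem_Iw0 (hk : Admissible k a) {φ : AdelicUnits → ℚ_[5][X]}
    (h : φ ∈ classicalFormsPart k a Iw) {w : (Matrix (Fin 2) (Fin 2) ℤ_[5])ˣ}
    (hw : bottomRow w 0 = 0) : formAct k (unitQ w) φ = φ := by
  ext1 g
  obtain ⟨δ, u, γ, hu, hg⟩ := exists_decomposition (g * (at5 (unitQ w))⁻¹)
  obtain ⟨x, rfl⟩ := isUnit_of_mem_Iw hu.2.1
  have hrow : bottomRow ((x * w : (Matrix (Fin 2) (Fin 2) ℤ_[5])ˣ) :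
      Matrix (Fin 2) (Fin 2) ℤ_[5]) 0 = 0 := by
    rw [Units.val_mul, bottomRow_mul, (mem_Iw_iff.mp hu.2.1).2, ← bottomRow_one, ← bottomRow_mul,
      one_mul, hw]
  have hl : InLevel Iw0 (u * at5 (unitQ w)) (x * w : (Matrix (Fin 2) (Fin 2) ℤ_[5])ˣ) := by
    refine ⟨fun p hp => ?_, ⟨Units.isUnit _, hrow⟩, ?_⟩
    · rw [RestrictedProduct.mul_apply, at5_apply_of_ne _ hp, mul_one]
      exact hu.1 p hp
    · rw [RestrictedProduct.mul_apply, Units.val_mul, map_mul, split_at5, hu.2.2]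
      exact (toQ_mul _ _).symm
  have hg' : g = diag δ * (u * at5 (unitQ w)) := by
    rw [← mul_assoc, ← hg, inv_mul_cancel_right]
  rw [formAct_apply, hg, classicalForms_apply h.1 hu, hg', h.1.2.1, apply_of_inLevel_Iw0 hk h hl,
    ← coe_unitQ (x * w), map_mul, polyAct_mul _ _ (h.1.1 1)]
  rfl

/-- By `Γ₀(5)`-invariance a translate by `GL₂(ℤ_5)` depends only on the point of `ℙ¹(𝔽_5)` given by
the bottom row. -/
theorem formAct_congr (hk : Admissible k a) {φ : AdelicUnits → ℚ_[5][X]}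
    (h : φ ∈ classicalFormsPart k a Iw) {w w' : (Matrix (Fin 2) (Fin 2) ℤ_[5])ˣ} (c : ZMod 5)
    (hw : bottomRow w = c • bottomRow w') : formAct k (unitQ w) φ = formAct k (unitQ w') φ := by
  have hrow : bottomRow ((w * w'⁻¹ : (Matrix (Fin 2) (Fin 2) ℤ_[5])ˣ) :
      Matrix (Fin 2) (Fin 2) ℤ_[5]) 0 = 0 := by
    rw [Units.val_mul, bottomRow_mul, hw, Matrix.smul_vecMul, ← bottomRow_mul, Units.mul_inv,
      bottomRow_one]
    simp
  rw [show w = w * w'⁻¹ * w' by group, map_mul, formAct_mul _ _ h.1.1, formAct_of_mem_Iw0 hk h hrow]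

/-! ### The trace to level `GL₂(ℤ_5)` -/

theorem exists_bottomRow_eq (r : Fin 2 → ZMod 5) (hr : r ≠ 0) :
    ∃ w : (Matrix (Fin 2) (Fin 2) ℤ_[5])ˣ, bottomRow w = r := by
  obtain ⟨-, -, γ, -, ⟨w, rfl⟩, h⟩ := exists_unit_bottomRow r hr
  exact ⟨w, h⟩

open Classical in
/-- A matrix in `GL₂(ℤ_5)` with given nonzero bottom row modulo `5`. -/
noncomputable def rowRep (r : Fin 2 → ZMod 5) : (Matrix (Fin 2) (Fin 2) ℤ_[5])ˣ :=
  if h : r ≠ 0 then (exists_bottomRow_eq r h).choose else 1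

theorem bottomRow_rowRep {r : Fin 2 → ZMod 5} (hr : r ≠ 0) : bottomRow (rowRep r) = r := by
  rw [rowRep, dif_pos hr]
  exact (exists_bottomRow_eq r hr).choose_spec

theorem bottomRow_ne_zero (w : (Matrix (Fin 2) (Fin 2) ℤ_[5])ˣ) : bottomRow w ≠ 0 := fun h => by
  have h1 := bottomRow_mul w (w⁻¹ : (Matrix (Fin 2) (Fin 2) ℤ_[5])ˣ)
  rw [h, Matrix.zero_vecMul, Units.mul_inv, bottomRow_one] at h1
  simpa using congrFun h1 1

/-- The trace from level `Γ̂₁(5)` to level `GL₂(ℤ_5)`. -/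
noncomputable def trace (k : ℕ) : (AdelicUnits → ℚ_[5][X]) →ₗ[ℚ_[5]] (AdelicUnits → ℚ_[5][X]) :=
  ∑ r : Fin 2 → ZMod 5 with r ≠ 0, formAct k (unitQ (rowRep r))

theorem trace_apply (φ : AdelicUnits → ℚ_[5][X]) :
    trace k φ = ∑ r : Fin 2 → ZMod 5 with r ≠ 0, formAct k (unitQ (rowRep r)) φ := by
  rw [trace, LinearMap.sum_apply]

/-- Right multiplication by `w` permutes the nonzero rows that index the sum. -/
theorem formAct_trace (hk : Admissible k a) {φ : AdelicUnits → ℚ_[5][X]}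
    (h : φ ∈ classicalFormsPart k a Iw) (w : (Matrix (Fin 2) (Fin 2) ℤ_[5])ˣ) :
    formAct k (unitQ w) (trace k φ) = trace k φ := by
  rw [trace_apply, map_sum]
  have hinv : ∀ (r : Fin 2 → ZMod 5) (x : (Matrix (Fin 2) (Fin 2) ℤ_[5])ˣ), r ≠ 0 →
      Matrix.vecMul r (red.mapMatrix x) = bottomRow (rowRep r * x) := fun r x hr => by
    rw [bottomRow_mul, bottomRow_rowRep hr]
  have hcancel : ∀ (r : Fin 2 → ZMod 5) (x y : (Matrix (Fin 2) (Fin 2) ℤ_[5])ˣ), x * y = 1 →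
      Matrix.vecMul (Matrix.vecMul r (red.mapMatrix x)) (red.mapMatrix y) = r := by
    intro r x y hxy
    rw [Matrix.vecMul_vecMul, ← map_mul, ← Units.val_mul, hxy, Units.val_one, map_one,
      Matrix.vecMul_one]
  refine Finset.sum_nbij' (fun r => Matrix.vecMul r (red.mapMatrix w))
    (fun r => Matrix.vecMul r (red.mapMatrix (w⁻¹ : (Matrix (Fin 2) (Fin 2) ℤ_[5])ˣ)))
    ?_ ?_ ?_ ?_ ?_
  · intro r hr
    rw [Finset.mem_filter_univ] at hr ⊢
    rw [hinv r w hr]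
    exact bottomRow_ne_zero (rowRep r * w)
  · intro r hr
    rw [Finset.mem_filter_univ] at hr ⊢
    rw [hinv r w⁻¹ hr]
    exact bottomRow_ne_zero (rowRep r * w⁻¹)
  · exact fun r _ => hcancel r _ _ (mul_inv_cancel w)
  · exact fun r _ => hcancel r _ _ (inv_mul_cancel w)
  · intro r hr
    rw [Finset.mem_filter_univ] at hr
    have hne : bottomRow (rowRep r * w) ≠ 0 := bottomRow_ne_zero (rowRep r * w)
    rw [← formAct_mul _ _ h.1.1, ← map_mul, hinv r w hr]
    refine formAct_congr hk h 1 ?_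
    rw [bottomRow_rowRep hne, one_smul]
    rfl

theorem U2_formAct (φ : AdelicUnits → ℚ_[5][X]) (A : (Matrix (Fin 2) (Fin 2) ℚ_[5])ˣ) :
    U2 (formAct k A φ) = formAct k A (U2 φ) := by
  ext1 g
  rw [U2_apply, formAct_apply, formAct_apply, U2_apply, mul_assoc, mul_assoc, ← map_inv,
    (commute_at5 A⁻¹ (pi2Adele_of_ne five_ne_two)).eq]

theorem trace_mem (hk : Admissible k a) {φ : AdelicUnits → ℚ_[5][X]}
    (h : φ ∈ classicalFormsPart k a Iw) : trace k φ ∈ classicalFormsPart k a GL2Z5 := by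
  have h2 := Module.End.mem_eigenspace_iff.mp h.2
  refine ⟨(mem_classicalForms_iff (fun γ hγ => (Matrix.isUnit_iff_isUnit_det _).mpr hγ)
    (by change IsUnit _; rw [Matrix.det_one]; exact isUnit_one)).mpr
    ⟨?_, fun w _ => formAct_trace hk h w⟩, ?_⟩
  · rw [trace_apply]
    exact IsForm.sum fun r _ => (isForm_of_mem h.1).formAct _
  · refine Module.End.mem_eigenspace_iff.mpr ?_
    rw [trace_apply, map_sum, Finset.smul_sum]
    refine Finset.sum_congr rfl fun r _ => ?_
    rw [U2_formAct, h2, map_smul]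

/-- Each of the six points of `ℙ¹(𝔽_5)` is represented by four nonzero rows. -/
theorem sum_rows {M : Type*} [AddCommGroup M] (F : (Fin 2 → ZMod 5) → M)
    (hF : ∀ c : ZMod 5, c ≠ 0 → ∀ r, F (c • r) = F r) :
    ∑ r : Fin 2 → ZMod 5 with r ≠ 0, F r =
      4 • (∑ i ∈ Finset.range 5, F ![(i : ZMod 5), 1] + F ![1, 0]) := by
  let rep : Fin 6 → Fin 2 → ZMod 5 := ![![0, 1], ![1, 1], ![2, 1], ![3, 1], ![4, 1], ![1, 0]]
  let sc : Fin 4 → ZMod 5 := ![1, 2, 3, 4]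
  have himg : (Finset.univ.filter fun r : Fin 2 → ZMod 5 => r ≠ 0) =
      Finset.univ.image (fun p : Fin 4 × Fin 6 => sc p.1 • rep p.2) := by decide +kernel
  have hinj : Function.Injective (fun p : Fin 4 × Fin 6 => sc p.1 • rep p.2) := by
    decide +kernel
  have hsc : ∀ c, sc c ≠ 0 := by decide
  rw [himg, Finset.sum_image hinj.injOn, Fintype.sum_prod_type]
  simp only [hF _ (hsc _), Finset.sum_const, Finset.card_univ, Fintype.card_fin]
  congr 1
  simp [rep, Fin.sum_univ_six, Finset.sum_range_succ]

end HeckeFive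

namespace HeckeFive

variable {k a : ℕ}

/-! ### `U₅` on classical forms -/

/-- `v_i` as an element of `GL₂(ℚ_5)`. -/
noncomputable def vUnit (i : ℕ) : (Matrix (Fin 2) (Fin 2) ℚ_[5])ˣ := (isUnit_v i).unit

@[simp] theorem coe_vUnit (i : ℕ) : (vUnit i : Matrix (Fin 2) (Fin 2) ℚ_[5]) = toQ (v i) := rfl

/-- The operator `U₅` on classical forms. -/
noncomputable def classicalU5 (k : ℕ) :
    (AdelicUnits → ℚ_[5][X]) →ₗ[ℚ_[5]] (AdelicUnits → ℚ_[5][X]) :=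
  ∑ i ∈ Finset.range 5, formAct k (vUnit i)

theorem classicalU5_apply (φ : AdelicUnits → ℚ_[5][X]) :
    classicalU5 k φ = ∑ i ∈ Finset.range 5, formAct k (vUnit i) φ := by
  rw [classicalU5, LinearMap.sum_apply]

/-- The matrix `(1 0; i 1)`. -/
noncomputable def lowerUnit (i : ℕ) : (Matrix (Fin 2) (Fin 2) ℤ_[5])ˣ where
  val := !![1, 0; (i : ℤ_[5]), 1]
  inv := !![1, 0; -(i : ℤ_[5]), 1]
  val_inv := by
    ext1 i j
    fin_cases i <;> fin_cases j <;> simp [Matrix.mul_apply, Fin.sum_univ_two]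
  inv_val := by
    ext1 i j
    fin_cases i <;> fin_cases j <;> simp [Matrix.mul_apply, Fin.sum_univ_two]

/-- The matrix `(0 1; 1 0)`. -/
noncomputable def swapUnit : (Matrix (Fin 2) (Fin 2) ℤ_[5])ˣ where
  val := !![0, 1; 1, 0]
  inv := !![0, 1; 1, 0]
  val_inv := by
    ext1 i j
    fin_cases i <;> fin_cases j <;> simp [Matrix.mul_apply, Fin.sum_univ_two]
  inv_val := by
    ext1 i j
    fin_cases i <;> fin_cases j <;> simp [Matrix.mul_apply, Fin.sum_univ_two]

theorem coe_padicInt_five : ((5 : ℤ_[5]) : ℚ_[5]) = 5 := by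
  have := PadicInt.coe_natCast (p := 5) 5
  exact_mod_cast this

theorem vUnit_eq (i : ℕ) : vUnit i = unitQ (lowerUnit i) * vUnit 0 := by
  refine Units.ext ?_
  rw [Units.val_mul, coe_vUnit, coe_vUnit, coe_unitQ, ← toQ_mul]
  congr 1
  ext1 i j
  fin_cases i <;> fin_cases j <;> simp [Matrix.mul_apply, Fin.sum_univ_two, lowerUnit, v, mul_comm]

/-- On forms of trace zero, `U₅` is the negative of the Atkin–Lehner operator. -/
theorem classicalU5_of_trace_eq_zero (hk : Admissible k a) {φ : AdelicUnits → ℚ_[5][X]}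
    (h : φ ∈ classicalFormsPart k a Iw) (h0 : trace k φ = 0) :
    classicalU5 k φ = -formAct k (unitQ swapUnit * vUnit 0) φ := by
  rw [trace_apply, sum_rows (fun r => formAct k (unitQ (rowRep r)) φ)] at h0
  · have h1 : ∑ i ∈ Finset.range 5, formAct k (unitQ (rowRep ![(i : ZMod 5), 1])) φ +
        formAct k (unitQ (rowRep ![1, 0])) φ = 0 :=
      (smul_eq_zero.mp h0).resolve_left (by norm_num)
    have h2 : ∀ i : ℕ, formAct k (unitQ (rowRep ![(i : ZMod 5), 1])) φ =
        formAct k (unitQ (lowerUnit i)) φ := fun i => by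
      refine formAct_congr hk h 1 ?_
      rw [bottomRow_rowRep, one_smul, bottomRow_eq]
      · simp [lowerUnit]
      · intro h
        simpa using congrFun h 1
    have h3 : formAct k (unitQ (rowRep ![1, 0])) φ = formAct k (unitQ swapUnit) φ := by
      refine formAct_congr hk h 1 ?_
      rw [bottomRow_rowRep, one_smul, bottomRow_eq]
      · simp [swapUnit]
      · intro h
        simpa using congrFun h 0
    simp only [h2, h3] at h1
    rw [classicalU5_apply, formAct_mul _ _ h.1.1, ← map_neg, ← eq_neg_of_add_eq_zero_left h1,
      map_sum]
    refine Finset.sum_congr rfl fun i _ => ?_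
    rw [vUnit_eq, formAct_mul _ _ h.1.1]
  · intro c hc r
    by_cases hr : r = 0
    · rw [hr, smul_zero]
    · refine formAct_congr hk h c ?_
      rw [bottomRow_rowRep hr, bottomRow_rowRep (smul_ne_zero hc hr)]

/-! ### The Atkin–Lehner operator on values at 1. -/

theorem normSq_quat_zero_one_zero_two : Quaternion.normSq (quat (0 : ℚ) 1 0 2) = 5 := by
  rw [normSq_eq]
  norm_num

/-- The element `i + 2k` is a unit away from 5, and at 5 it is antidiagonal, equal to a diagonal
unit `w` times the Atkin–Lehner matrix. Left invariance lets it trade the translation for `w`, and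
the two actions at 5 combine to that of its antidiagonal image. -/
theorem atkinLehner_apply_one (hk : Admissible k a) {φ : AdelicUnits → ℚ_[5][X]}
    (h : φ ∈ classicalFormsPart k a Iw) :
    ∃ s t : ℚ_[5], formAct k (unitQ swapUnit * vUnit 0) φ 1 = polyAct k !![0, s; t, 0] (φ 1) := by
  have hx : quat (0 : ℚ) 1 0 2 ∈ hurwitzOrder := by
    simpa using quat_intCast_mem 0 1 0 2
  have hx0 : quat (0 : ℚ) 1 0 2 ≠ 0 :=
    Quaternion.normSq_ne_zero.mp (by rw [normSq_quat_zero_one_zero_two]; norm_num)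
  set δ := Units.mk0 _ hx0 with hδ
  obtain ⟨y, hy⟩ := five_dvd_nu_sub_two
  have hv := nu_mul_nu
  have hnu : nu = 2 + 5 * y := by linear_combination hy
  -- With `ν = 2 + 5y` one has `-1 - 2ν = 5 (-1 - 2y)`, and `(1 - 2ν)(-1 - 2ν) = -5`; so `w` is
  -- invertible.
  have hst : (1 - 2 * nu) * (-1 - 2 * y) = -1 := by
    refine mul_left_cancel₀ (a := (5 : ℤ_[5])) (by norm_num) ?_
    rw [show (5 : ℤ_[5]) * ((1 - 2 * nu) * (-1 - 2 * y)) = (1 - 2 * nu) * (-1 - 2 * nu) by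
      rw [hnu]; ring]
    linear_combination 4 * hv
  let w : (Matrix (Fin 2) (Fin 2) ℤ_[5])ˣ :=
    { val := !![1 - 2 * nu, 0; 0, -1 - 2 * y]
      inv := !![1 + 2 * y, 0; 0, -(1 - 2 * nu)]
      val_inv := by
        ext1 i j
        fin_cases i <;> fin_cases j <;> simp [Matrix.mul_apply, Fin.sum_univ_two]
        · linear_combination -hst
        · linear_combination -hst
      inv_val := by
        ext1 i j
        fin_cases i <;> fin_cases j <;> simp [Matrix.mul_apply, Fin.sum_univ_two]
        · linear_combination -hst
        · linear_combination -hst }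
  have hsplit : split (localMap five δ) = toQ w * (unitQ swapUnit * vUnit 0 :
      (Matrix (Fin 2) (Fin 2) ℚ_[5])ˣ) := by
    rw [Units.val_mul, coe_unitQ, coe_vUnit, ← toQ_mul, ← toQ_mul, hδ, Units.val_mk0,
      localMap_apply]
    have e : ((1 - 2 * nu : ℤ_[5]) : ℚ_[5]) = 1 - 2 * nuQ := by
      push_cast; rw [coe_padicInt_two]
    have e' : (((-1 - 2 * y) * 5 : ℤ_[5]) : ℚ_[5]) = -1 - 2 * nuQ := by
      rw [nuQ, hnu]; push_cast; rw [coe_padicInt_two, coe_padicInt_five]; ring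
    ext i j
    fin_cases i <;> fin_cases j <;>
      simp [split, w, swapUnit, v, -PadicInt.coe_mul, -PadicInt.coe_sub, e, e']
  have hlevel : InLevel Iw0 (diag δ * (at5 (unitQ swapUnit * vUnit 0))⁻¹) w := by
    refine ⟨fun p hp => ?_, ⟨w.isUnit, by rw [bottomRow_eq]; simp [w]⟩, ?_⟩
    · rw [RestrictedProduct.mul_apply, RestrictedProduct.inv_apply, at5_apply_of_ne _ hp, inv_one,
        mul_one, diag_apply]
      exact localUnit_mem_of_normSq hp hx (by
        rw [hδ, Units.val_mk0, normSq_quat_zero_one_zero_two]; norm_num)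
    · rw [← map_inv, RestrictedProduct.mul_apply, Units.val_mul, map_mul, split_at5]
      refine (congrArg (· * _) hsplit).trans ?_
      change _ * _ * _ = toQ w
      rw [mul_assoc, Units.mul_inv, mul_one]
  have h1 := apply_of_inLevel_Iw0 hk h hlevel
  rw [h.1.2.1] at h1
  refine ⟨1 - 2 * nuQ, -1 - 2 * nuQ, ?_⟩
  rw [formAct_apply, one_mul, h1, ← coe_unitQ, ← polyAct_mul _ _ (h.1.1 1), Units.val_mul,
    coe_unitQ w, ← hsplit]
  congr 2
  rw [hδ, Units.val_mk0, localMap_apply]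
  ext i j
  fin_cases i <;> fin_cases j <;> simp [split]

/-- An antidiagonal matrix sends `z^j` to a multiple of `z^(k-2-j)`. -/
theorem coeff_polyAct_of_antidiagonal (s t : ℚ_[5]) {f : ℚ_[5][X]} {i : ℕ} (hi : i < k - 1)
    (hf : f.coeff (k - 2 - i) = 0) : (polyAct k !![0, s; t, 0] f).coeff i = 0 := by
  rw [polyAct_apply, finsetSum_coeff]
  refine Finset.sum_eq_zero fun j hj => ?_
  rw [Finset.mem_range] at hj
  have : (C ((!![0, s; t, 0] : Matrix (Fin 2) (Fin 2) ℚ_[5]) 0 0) * X +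
      C ((!![0, s; t, 0] : Matrix (Fin 2) (Fin 2) ℚ_[5]) 0 1)) ^ j *
      (C ((!![0, s; t, 0] : Matrix (Fin 2) (Fin 2) ℚ_[5]) 1 0) * X +
      C ((!![0, s; t, 0] : Matrix (Fin 2) (Fin 2) ℚ_[5]) 1 1)) ^ (k - 2 - j) =
      C (s ^ j * t ^ (k - 2 - j)) * X ^ (k - 2 - j) := by
    simp only [Matrix.of_apply, Matrix.cons_val_zero, Matrix.cons_val_one, C_0, add_zero, zero_mul,
      zero_add, C_mul, C_pow]
    ring
  rw [this, coeff_smul, coeff_C_mul_X_pow]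
  split_ifs with h
  · obtain rfl : j = k - 2 - i := by lia
    rw [hf, zero_smul]
  · exact smul_zero _

theorem coeff_classicalU5_of_trace_eq_zero (hk : Admissible k a) {φ : AdelicUnits → ℚ_[5][X]}
    (h : φ ∈ classicalFormsPart k a Iw) (h0 : trace k φ = 0) {i : ℕ} (hi : i < k - 1)
    (hf : (φ 1).coeff (k - 2 - i) = 0) : (classicalU5 k φ 1).coeff i = 0 := by
  obtain ⟨s, t, hst⟩ := atkinLehner_apply_one hk h
  rw [classicalU5_of_trace_eq_zero hk h h0, Pi.neg_apply, hst, coeff_neg,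
    coeff_polyAct_of_antidiagonal s t hi hf, neg_zero]

/-! ### Expansions in the Tate algebra -/

/-- `c` is an absolutely summable coefficient sequence of `f`. -/
def IsAbsExpansion (c : ℕ → ℚ_[5]) (f : ℤ_[5] → ℚ_[5]) : Prop :=
  Summable (fun n => ‖c n‖) ∧ ∀ z : ℤ_[5], HasSum (fun n => c n * (z : ℚ_[5]) ^ n) (f z)

/-- The functions with an absolutely summable expansion. -/
def absTate : Set (ℤ_[5] → ℚ_[5]) := {f | ∃ c, IsAbsExpansion c f}

theorem IsAbsExpansion.isTateExpansion {c : ℕ → ℚ_[5]} {f : ℤ_[5] → ℚ_[5]}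
    (h : IsAbsExpansion c f) : IsTateExpansion c f :=
  ⟨tendsto_zero_iff_norm_tendsto_zero.mpr h.1.tendsto_atTop_zero, h.2⟩

theorem absTate_subset_tate : absTate ⊆ tate := fun _ ⟨c, hc⟩ => ⟨c, hc.isTateExpansion⟩

theorem isAbsExpansion_eval (p : ℚ_[5][X]) :
    IsAbsExpansion p.coeff (fun z => p.eval (z : ℚ_[5])) := by
  have h0 : ∀ n ∉ Finset.range (p.natDegree + 1), p.coeff n = 0 := fun n hn =>
    coeff_eq_zero_of_natDegree_lt (by simpa using hn)
  refine ⟨summable_of_ne_finset_zero (s := Finset.range (p.natDegree + 1)) fun n hn => by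
    rw [h0 n hn, norm_zero], fun z => ?_⟩
  simp only [eval_eq_sum_range]
  exact hasSum_sum_of_ne_finset_zero fun n hn => by rw [h0 n hn, zero_mul]

theorem eval_mem_absTate (p : ℚ_[5][X]) : (fun z : ℤ_[5] => p.eval (z : ℚ_[5])) ∈ absTate :=
  ⟨_, isAbsExpansion_eval p⟩

/-- The Cauchy product is available for absolutely summable series. The functions needed below are
built from polynomials and geometric series, so this smaller class suffices. -/
theorem mul_mem_absTate {f g : ℤ_[5] → ℚ_[5]} (hf : f ∈ absTate) (hg : g ∈ absTate) :
    f * g ∈ absTate := by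
  obtain ⟨c, hc, hcf⟩ := hf
  obtain ⟨d, hd, hdg⟩ := hg
  refine ⟨fun n => ∑ kl ∈ Finset.HasAntidiagonal.antidiagonal n, c kl.1 * d kl.2,
    summable_norm_sum_mul_antidiagonal_of_summable_norm hc hd, fun z => ?_⟩
  have hz : ∀ {c : ℕ → ℚ_[5]}, Summable (fun n => ‖c n‖) →
      Summable (fun n => ‖c n * (z : ℚ_[5]) ^ n‖) := fun {c} hc => by
    refine Summable.of_nonneg_of_le (fun _ => norm_nonneg _) (fun n => ?_) hc
    rw [norm_mul, norm_pow]
    exact mul_le_of_le_one_right (norm_nonneg _) (pow_le_one₀ (norm_nonneg _) z.2)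
  have e : ∀ n, (∑ kl ∈ Finset.HasAntidiagonal.antidiagonal n, c kl.1 * d kl.2) * (z : ℚ_[5]) ^ n =
      ∑ kl ∈ Finset.HasAntidiagonal.antidiagonal n,
        c kl.1 * (z : ℚ_[5]) ^ kl.1 * (d kl.2 * (z : ℚ_[5]) ^ kl.2) :=
    fun n => by
      rw [Finset.sum_mul]
      refine Finset.sum_congr rfl fun kl hkl => ?_
      rw [← Finset.HasAntidiagonal.mem_antidiagonal.mp hkl, pow_add]
      ring
  simp only [e]
  have hs := (summable_norm_sum_mul_antidiagonal_of_summable_norm (hz hc) (hz hd)).of_norm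
  rw [Pi.mul_apply, ← (hcf z).tsum_eq, ← (hdg z).tsum_eq,
    tsum_mul_tsum_eq_tsum_sum_antidiagonal_of_summable_norm (hz hc) (hz hd)]
  exact hs.hasSum

theorem pow_mem_absTate {f : ℤ_[5] → ℚ_[5]} (hf : f ∈ absTate) (n : ℕ) : f ^ n ∈ absTate := by
  induction n with
  | zero =>
    have := eval_mem_absTate 1
    simp only [eval_one] at this
    rw [pow_zero]
    exact this
  | succ n ih => rw [pow_succ]; exact mul_mem_absTate ih hf

theorem linear_mem_absTate (a b : ℤ_[5]) :
    (fun z : ℤ_[5] => ((a * z + b : ℤ_[5]) : ℚ_[5])) ∈ absTate := by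
  have := eval_mem_absTate (C (a : ℚ_[5]) * X + C (b : ℚ_[5]))
  simpa using this

/-- Geometric series in `-c z / d`, where `|c| < 1 = |d|`. -/
theorem inv_linear_mem_absTate {c d : ℤ_[5]} (hc : (5 : ℤ_[5]) ∣ c) (hd : IsUnit d) :
    (fun z : ℤ_[5] => ((c * z + d : ℤ_[5]) : ℚ_[5])⁻¹) ∈ absTate := by
  have hd1 : ‖(d : ℚ_[5])‖ = 1 := PadicInt.isUnit_iff.mp hd
  have hd0 : (d : ℚ_[5]) ≠ 0 := norm_ne_zero_iff.mp (by rw [hd1]; exact one_ne_zero)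
  have hc1 : ‖(c : ℚ_[5])‖ < 1 := (PadicInt.norm_lt_one_iff_dvd c).mpr (by exact_mod_cast hc)
  have hq : ‖-(c : ℚ_[5]) / d‖ < 1 := by rwa [norm_div, norm_neg, hd1, div_one]
  refine ⟨fun n => (d : ℚ_[5])⁻¹ * (-(c : ℚ_[5]) / d) ^ n, ?_, fun z => ?_⟩
  · simp only [norm_mul, norm_pow, norm_inv, hd1, inv_one, one_mul]
    exact summable_geometric_of_lt_one (norm_nonneg _) hq
  · have hqz : ‖-(c : ℚ_[5]) / d * z‖ < 1 := by
      rw [norm_mul]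
      exact (mul_le_of_le_one_right (norm_nonneg _) z.2).trans_lt hq
    have h := (hasSum_geometric_of_norm_lt_one hqz).mul_left (d : ℚ_[5])⁻¹
    have e : (d : ℚ_[5])⁻¹ * (1 - -(c : ℚ_[5]) / d * z)⁻¹ = ((c * z + d : ℤ_[5]) : ℚ_[5])⁻¹ := by
      rw [← mul_inv]
      congr 1
      push_cast
      field_simp
      ring
    simp only [← e, mul_assoc, ← mul_pow]
    exact h

/-- The closed unit ball is a neighbourhood of 0 in `ℚ_5`, so both sequences are power series at 0
of the same function; its default value off the ball plays no role. -/
theorem IsTateExpansion.unique {c d : ℕ → ℚ_[5]} {f : ℤ_[5] → ℚ_[5]} (hc : IsTateExpansion c f)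
    (hd : IsTateExpansion d f) : c = d := by
  have key : ∀ {c : ℕ → ℚ_[5]}, IsTateExpansion c f → HasFPowerSeriesAt
      (fun z : ℚ_[5] => if h : ‖z‖ ≤ 1 then f ⟨z, h⟩ else 0)
      (FormalMultilinearSeries.ofScalars ℚ_[5] c) 0 := fun {c} hc => by
    rw [hasFPowerSeriesAt_iff]
    filter_upwards [Metric.closedBall_mem_nhds (0 : ℚ_[5]) one_pos] with z hz
    rw [mem_closedBall_zero_iff] at hz
    rw [zero_add, dif_pos hz]
    have := hc.2 ⟨z, hz⟩
    simpa [FormalMultilinearSeries.coeff_ofScalars, mul_comm] using this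
  have h := (key hc).eq_formalMultilinearSeries (key hd)
  ext n
  have := congrArg (fun p => FormalMultilinearSeries.coeff p n) h
  simpa [FormalMultilinearSeries.coeff_ofScalars] using this

/-! ### Overconvergent forms -/

/-- The monoid of matrices `(a b; c d)` with `c ∈ 5 ℤ_5` and `d ∈ ℤ_5ˣ`. -/
def Sigma0 : Set (Matrix (Fin 2) (Fin 2) ℤ_[5]) := {γ | (5 : ℤ_[5]) ∣ γ 1 0 ∧ IsUnit (γ 1 1)}

theorem isUnit_linear {c d : ℤ_[5]} (hc : (5 : ℤ_[5]) ∣ c) (hd : IsUnit d) (z : ℤ_[5]) :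
    IsUnit (c * z + d) := by
  rw [← red_ne_zero_iff] at hd ⊢
  rw [map_add, map_mul, red_eq_zero_iff.mpr hc, zero_mul, zero_add]
  exact hd

theorem mul_inv_of_isUnit {x : ℤ_[5]} (hx : IsUnit x) : x * PadicInt.inv x = 1 :=
  PadicInt.mul_inv (PadicInt.isUnit_iff.mp hx)

theorem coe_inv_of_isUnit {x : ℤ_[5]} (hx : IsUnit x) :
    (PadicInt.inv x : ℚ_[5]) = (x : ℚ_[5])⁻¹ := by
  have := congrArg (fun x : ℤ_[5] => (x : ℚ_[5])) (mul_inv_of_isUnit hx)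
  simp only [PadicInt.coe_mul, PadicInt.coe_one] at this
  exact eq_inv_of_mul_eq_one_right this

theorem coe_ne_zero_of_isUnit {x : ℤ_[5]} (hx : IsUnit x) : (x : ℚ_[5]) ≠ 0 := fun h =>
  hx.ne_zero (PadicInt.ext h)

theorem Iw_subset_Sigma0 : Iw ⊆ Sigma0 := fun γ h => ⟨h.2.1, by
  have h1 := (mem_Iw_iff.mp h).2
  rw [bottomRow_eq] at h1
  have h2 : red (γ 1 1) = 1 := congrFun h1 1
  rw [← red_ne_zero_iff, h2]
  exact one_ne_zero⟩

theorem v_mem_Sigma0 (i : ℕ) : v i ∈ Sigma0 := ⟨⟨i, rfl⟩, isUnit_one⟩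

theorem mul_mem_Sigma0 {γ γ' : Matrix (Fin 2) (Fin 2) ℤ_[5]} (h : γ ∈ Sigma0) (h' : γ' ∈ Sigma0) :
    γ * γ' ∈ Sigma0 := by
  refine ⟨?_, ?_⟩
  · rw [Matrix.mul_apply, Fin.sum_univ_two]
    exact dvd_add (h.1.mul_right _) (h'.1.mul_left _)
  · rw [Matrix.mul_apply, Fin.sum_univ_two]
    have := isUnit_linear h.1 (h.2.mul h'.2) (γ' 0 1)
    exact this

theorem slash_slash (k : ℤ) {γ γ' : Matrix (Fin 2) (Fin 2) ℤ_[5]} (h : γ ∈ Sigma0)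
    (h' : γ' ∈ Sigma0) (f : ℤ_[5] → ℚ_[5]) :
    slash k γ' (slash k γ f) = slash k (γ * γ') f := by
  ext z
  have hu' := isUnit_linear h'.1 h'.2 z
  have hu := isUnit_linear h.1 h.2 ((γ' 0 0 * z + γ' 0 1) * PadicInt.inv (γ' 1 0 * z + γ' 1 1))
  have huu := isUnit_linear (mul_mem_Sigma0 h h').1 (mul_mem_Sigma0 h h').2 z
  have hi' := mul_inv_of_isUnit hu'
  have hi := mul_inv_of_isUnit hu
  have hii := mul_inv_of_isUnit huu
  simp only [slash]
  have e1 : (γ * γ') 1 0 * z + (γ * γ') 1 1 = (γ' 1 0 * z + γ' 1 1) *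
      (γ 1 0 * ((γ' 0 0 * z + γ' 0 1) * PadicInt.inv (γ' 1 0 * z + γ' 1 1)) + γ 1 1) := by
    simp only [Matrix.mul_apply, Fin.sum_univ_two]
    linear_combination (-(γ 1 0 * (γ' 0 0 * z + γ' 0 1))) * hi'
  rw [e1, PadicInt.coe_mul, mul_zpow, mul_assoc]
  congr 3
  -- `PadicInt.inv` inverts units only. Clearing the unit denominators leaves a combination of the
  -- three relations `x * inv x = 1`.
  refine hu.mul_right_cancel (hu'.mul_right_cancel ?_)
  rw [e1] at hii
  simp only [Matrix.mul_apply, Fin.sum_univ_two]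
  generalize PadicInt.inv (γ' 1 0 * z + γ' 1 1) = i at *
  generalize PadicInt.inv (γ 1 0 * ((γ' 0 0 * z + γ' 0 1) * i) + γ 1 1) = i2 at *
  generalize PadicInt.inv ((γ' 1 0 * z + γ' 1 1) *
    (γ 1 0 * ((γ' 0 0 * z + γ' 0 1) * i) + γ 1 1)) = i3 at *
  linear_combination (γ 0 0 * ((γ' 0 0 * z + γ' 0 1) * i) + γ 0 1) * (γ' 1 0 * z + γ' 1 1) * hi +
    γ 0 0 * (γ' 0 0 * z + γ' 0 1) * hi' -
    ((γ 0 0 * γ' 0 0 + γ 0 1 * γ' 1 0) * z + (γ 0 0 * γ' 0 1 + γ 0 1 * γ' 1 1)) * hii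

theorem slash_one (k : ℤ) (f : ℤ_[5] → ℚ_[5]) : slash k 1 f = f := by
  ext z
  have : PadicInt.inv (1 : ℤ_[5]) = 1 := by
    have := mul_inv_of_isUnit (isUnit_one (M := ℤ_[5]))
    rwa [one_mul] at this
  simp [slash, this]

/-- The function `z ↦ z^j`. -/
noncomputable def monom (j : ℕ) : ℤ_[5] → ℚ_[5] := fun z => (z : ℚ_[5]) ^ j

theorem slash_monom_mem_absTate (k : ℤ) {γ : Matrix (Fin 2) (Fin 2) ℤ_[5]} (h : γ ∈ Sigma0)
    (j : ℕ) : slash k γ (monom j) ∈ absTate := by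
  have hlin := linear_mem_absTate (γ 1 0) (γ 1 1)
  have hinv := inv_linear_mem_absTate h.1 h.2
  have hz : (fun z : ℤ_[5] => ((γ 1 0 * z + γ 1 1 : ℤ_[5]) : ℚ_[5]) ^ (k - 2)) ∈ absTate := by
    obtain ⟨n, hn | hn⟩ := (k - 2).eq_nat_or_neg
    · simp only [hn, zpow_natCast]
      exact pow_mem_absTate hlin n
    · simp only [hn, zpow_neg, zpow_natCast, ← inv_pow]
      exact pow_mem_absTate hinv n
  have := mul_mem_absTate hz
    (pow_mem_absTate (mul_mem_absTate (linear_mem_absTate (γ 0 0) (γ 0 1)) hinv) j)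
  convert this using 1
  ext z
  simp only [slash, monom, Pi.mul_apply, Pi.pow_apply, PadicInt.coe_mul,
    coe_inv_of_isUnit (isUnit_linear h.1 h.2 z)]

/-! ### Overconvergent forms determined by their value at 1. -/

theorem overconvergentForms_apply {k : ℤ} {φ : AdelicUnits → ℤ_[5] → ℚ_[5]}
    (h : φ ∈ overconvergentForms k) {δ : (ℍ[ℚ])ˣ} {u : AdelicUnits}
    {γ : Matrix (Fin 2) (Fin 2) ℤ_[5]} (hu : InLevel Iw u γ) :
    φ (diag δ * u) = slash k γ (φ 1) := by
  rw [h.2.1, ← one_mul u, h.2.2 1 u γ hu]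

theorem overconvergentForms_ext {k : ℤ} {φ ψ : AdelicUnits → ℤ_[5] → ℚ_[5]}
    (h : φ ∈ overconvergentForms k) (h' : ψ ∈ overconvergentForms k) (h1 : φ 1 = ψ 1) : φ = ψ := by
  ext1 g
  obtain ⟨δ, u, γ, hu, rfl⟩ := exists_decomposition g
  rw [overconvergentForms_apply h hu, overconvergentForms_apply h' hu, h1]

theorem exists_overconvergentForm (k : ℤ) (j : ℕ) :
    ∃ φ ∈ overconvergentForms k, φ 1 = monom j := by
  obtain ⟨φ, h1, hl, hr, hv⟩ := exists_form (slash k) (monom j) (slash_one k _)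
    fun γ hγ γ' hγ' => (slash_slash k (Iw_subset_Sigma0 hγ) (Iw_subset_Sigma0 hγ') _).symm
  refine ⟨φ, ⟨fun g => ?_, hl, hr⟩, h1⟩
  obtain ⟨γ, hγ, h⟩ := hv g
  rw [h]
  exact absTate_subset_tate (slash_monom_mem_absTate k (Iw_subset_Sigma0 hγ) j)

theorem isTateExpansion_sum {ι : Type*} (s : Finset ι) {c : ι → ℕ → ℚ_[5]}
    {f : ι → ℤ_[5] → ℚ_[5]} (h : ∀ i ∈ s, IsTateExpansion (c i) (f i)) :
    IsTateExpansion (fun n => ∑ i ∈ s, c i n) (∑ i ∈ s, f i) := by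
  refine ⟨?_, fun z => ?_⟩
  · simpa using tendsto_finsetSum s fun i hi => (h i hi).1
  · simp only [Finset.sum_mul, Finset.sum_apply]
    exact hasSum_sum fun i hi => (h i hi).2 z

theorem U5_apply_one_mem_tate {k : ℤ} {φ : AdelicUnits → ℤ_[5] → ℚ_[5]}
    (h : φ ∈ overconvergentForms k) {j : ℕ} (h1 : φ 1 = monom j) : U5 k φ 1 ∈ tate := by
  have key : ∀ i, slash k (v i) (φ (1 * (vAdele i)⁻¹)) ∈ tate := fun i => by
    obtain ⟨δ, u, γ, hu, hg⟩ := exists_decomposition (1 * (vAdele i)⁻¹)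
    rw [hg, overconvergentForms_apply h hu, h1,
      slash_slash k (Iw_subset_Sigma0 hu.2.1) (v_mem_Sigma0 i)]
    exact absTate_subset_tate (slash_monom_mem_absTate k
      (mul_mem_Sigma0 (Iw_subset_Sigma0 hu.2.1) (v_mem_Sigma0 i)) j)
  choose c hc using key
  exact ⟨_, isTateExpansion_sum _ fun i _ => hc i⟩

/-- Every monomial is the value at 1 of exactly one form. Existence of that form pins down each
column of `P`; its uniqueness makes the column well defined. -/
theorem existsUnique_isU5Matrix (k : ℤ) : ∃! P : ℕ → ℕ → ℚ_[5], IsU5Matrix k P := by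
  choose φ hφ h1 using exists_overconvergentForm k
  choose c hc using fun j => U5_apply_one_mem_tate (hφ j) (h1 j)
  refine ⟨fun i j => c j i, fun ψ hψ j hj => ?_, fun P hP => ?_⟩
  · rw [overconvergentForms_ext hψ (hφ j) (hj.trans (h1 j).symm)]
    exact hc j
  · ext i j
    exact congrFun ((hP (φ j) (hφ j) j (h1 j)).unique (hc j)) i

end HeckeFive

namespace HeckeFive

variable {k a : ℕ}

/-! ### Comparison of classical and overconvergent forms -/

theorem slash_eval {γ : Matrix (Fin 2) (Fin 2) ℤ_[5]} (h : γ ∈ Sigma0) {f : ℚ_[5][X]}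
    (hf : f ∈ degreeLT ℚ_[5] (k - 1)) :
    slash k γ (fun z => f.eval (z : ℚ_[5])) =
      fun z : ℤ_[5] => (polyAct k (toQ γ) f).eval (z : ℚ_[5]) := by
  ext z
  -- For `k ≥ 2` the integer and the truncated exponent `k - 2` agree; for `k < 2` the degree bound
  -- leaves only `f = 0`.
  by_cases hk : 2 ≤ k
  · have hu := isUnit_linear h.1 h.2 z
    have hne := coe_ne_zero_of_isUnit hu
    have e : (k : ℤ) - 2 = ((k - 2 : ℕ) : ℤ) := by lia
    rw [PadicInt.coe_add, PadicInt.coe_mul] at hne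
    simp only [slash, PadicInt.coe_mul, coe_inv_of_isUnit hu]
    rw [eval_polyAct _ hf hne, e, zpow_natCast]
    simp [div_eq_mul_inv]
  · have h0 : f = 0 := by
      rw [show k - 1 = 0 by lia, mem_degreeLT] at hf
      exact degree_eq_bot.mp (by simpa using hf)
    simp [slash, h0]

/-- The overconvergent form attached to a classical form. -/
noncomputable def evalForm (φ : AdelicUnits → ℚ_[5][X]) : AdelicUnits → ℤ_[5] → ℚ_[5] :=
  fun g z => (φ g).eval (z : ℚ_[5])

theorem evalForm_mem {φ : AdelicUnits → ℚ_[5][X]} (h : φ ∈ classicalForms k Iw) :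
    evalForm φ ∈ overconvergentForms k := by
  refine ⟨fun g => absTate_subset_tate (eval_mem_absTate _), fun δ g => ?_, fun g u γ hu => ?_⟩
  · ext1 z
    exact congrArg (eval (z : ℚ_[5])) (h.2.1 δ g)
  · change _ = slash k γ (fun z => (φ g).eval (z : ℚ_[5]))
    rw [slash_eval (Iw_subset_Sigma0 hu.2.1) (h.1 g)]
    ext1 z
    exact congrArg (eval (z : ℚ_[5])) (h.2.2 g u γ hu)

theorem U5_evalForm {φ : AdelicUnits → ℚ_[5][X]} (h : φ ∈ classicalForms k Iw) (g : AdelicUnits) :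
    U5 k (evalForm φ) g = evalForm (classicalU5 k φ) g := by
  ext z
  simp only [U5, evalForm, classicalU5_apply, Finset.sum_apply, eval_finsetSum]
  refine Finset.sum_congr rfl fun i _ => ?_
  exact congrFun (slash_eval (v_mem_Sigma0 i) (h.1 _)) z

/-- Classical forms embed `U₅`-equivariantly in overconvergent forms, so the columns of `P` in
degrees at most `k - 2` can be computed classically. -/
theorem isU5Matrix_apply {P : ℕ → ℕ → ℚ_[5]} (hP : IsU5Matrix k P) {φ : AdelicUnits → ℚ_[5][X]}
    (h : φ ∈ classicalForms k Iw) {m : ℕ} (h1 : φ 1 = X ^ m) (i : ℕ) :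
    P i m = (classicalU5 k φ 1).coeff i := by
  have e1 := hP _ (evalForm_mem h) m (by ext z; simp [evalForm, h1])
  rw [U5_evalForm h] at e1
  exact congrFun (e1.unique (isAbsExpansion_eval _).isTateExpansion) i

/-! ### The corank -/

theorem exists_form_X_pow (hk : Admissible k a) {j : ℕ} (hj : 4 * j + a < k - 1) :
    ∃ φ ∈ classicalFormsPart k a Iw, φ 1 = X ^ (4 * j + a) := by
  obtain ⟨φ, hφ, h1⟩ := exists_classicalForm (k := k) (f := X ^ (4 * j + a)) (by
    rw [mem_degreeLT, degree_X_pow]; exact_mod_cast hj)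
  refine ⟨φ, (mem_classicalFormsPart_iff (even_of_admissible hk) hφ).mpr fun m hm => ?_, h1⟩
  rw [h1, coeff_X_pow] at hm
  obtain rfl : m = 4 * j + a := by
    by_contra hne
    exact hm (if_neg hne)
  lia

/-- The coefficients of the value at `1` in the degrees `4 j + a`. -/
noncomputable def coeffMap (k a d : ℕ) : classicalFormsPart k a Iw →ₗ[ℚ_[5]] (Fin d → ℚ_[5]) :=
  LinearMap.pi fun j => lcoeff ℚ_[5] (4 * (j : ℕ) + a) ∘ₗ LinearMap.proj 1 ∘ₗ Submodule.subtype _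

/-- `(k + 2 - a) / 4` counts the degrees `m ≤ k - 2` congruent to `a` modulo 4, and is 0 when there
are none. -/
theorem coeffMap_injective (hk : Admissible k a) (ha : a < 4) :
    Function.Injective (coeffMap k a ((k + 2 - a) / 4)) := by
  rw [injective_iff_map_eq_zero]
  rintro ⟨φ, hφ⟩ h
  have h0 : φ = 0 := classicalForms_ext hφ.1 (Submodule.zero_mem _) <| by
    ext m
    by_contra hm
    have h1 := supportedOn_of_mem hk hφ m hm
    have hmk : m < k - 1 := by
      by_contra hmk
      exact hm (coeff_eq_zero_of_degree_lt <| (mem_degreeLT.mp (hφ.1.1 1)).trans_le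
        (by exact_mod_cast not_lt.mp hmk))
    have h2 := congrFun h ⟨m / 4, by lia⟩
    have h3 : 4 * (m / 4) + a = m := by lia
    apply hm
    simpa [coeffMap, h3] using h2
  exact Subtype.ext h0

theorem finite_classicalFormsPart (hk : Admissible k a) (ha : a < 4) :
    Module.Finite ℚ_[5] (classicalFormsPart k a Iw) :=
  Module.Finite.of_injective _ (coeffMap_injective hk ha)

theorem dIw_le (hk : Admissible k a) (ha : a < 4) : dIw k a ≤ (k + 2 - a) / 4 := by
  exact (LinearMap.finrank_le_finrank_of_injective (coeffMap_injective hk ha)).trans_eq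
    (Module.finrank_fin_fun _)

theorem classicalFormsPart_anti : classicalFormsPart k a GL2Z5 ≤ classicalFormsPart k a Iw :=
  inf_le_inf_right _ fun _ h => ⟨h.1, h.2.1, fun g u γ hu => h.2.2 g u γ
    ⟨hu.1, (Matrix.isUnit_iff_isUnit_det _).mp (isUnit_of_mem_Iw hu.2.1), hu.2.2⟩⟩

/-- Trace zero imposes at most `dUnr` linear conditions on the span of the first `e` monomials of
the block, and on what is left `U₅` reverses degrees out of the block. -/
theorem le_corank (hk : Admissible k a) (ha : a < 4) {P : ℕ → ℕ → ℚ_[5]}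
    (hP : IsU5Matrix k P) {n e : ℕ} (hen : e ≤ n)
    (hed : n + e ≤ (k + 2 - a) / 4) : e ≤ corank (minor P a n) + dUnr k a := by
  have hfin := finite_classicalFormsPart hk ha
  have hfin' : FiniteDimensional ℚ_[5] (classicalFormsPart k a GL2Z5) :=
    Submodule.finiteDimensional_of_le classicalFormsPart_anti
  choose ψ hψ hψ1 using fun j : Fin n => exists_form_X_pow hk (j := j) (by have := j.2; lia)
  let F : (Fin n → ℚ_[5]) →ₗ[ℚ_[5]] (AdelicUnits → ℚ_[5][X]) := Fintype.linearCombination ℚ_[5] ψ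
  have hF : ∀ y, F y ∈ classicalFormsPart k a Iw := fun y => by
    rw [Fintype.linearCombination_apply]
    exact Submodule.sum_mem _ fun j _ => Submodule.smul_mem _ _ (hψ j)
  let T : (Fin n → ℚ_[5]) →ₗ[ℚ_[5]] classicalFormsPart k a GL2Z5 :=
    LinearMap.codRestrict _ (trace k ∘ₗ F) fun y => trace_mem hk (hF y)
  -- The kernel of `S` consists of the vectors supported on the first `e` coordinates.
  let S : (Fin n → ℚ_[5]) →ₗ[ℚ_[5]] (Fin (n - e) → ℚ_[5]) :=
    LinearMap.pi fun i => LinearMap.proj ⟨e + i, by have := i.2; lia⟩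
  have hker : LinearMap.ker (T.prod S) ≤ LinearMap.ker (minor P a n).mulVecLin := by
    intro y hy
    rw [LinearMap.mem_ker] at hy
    have hT : trace k (F y) = 0 := congrArg (fun x => (x.1 : AdelicUnits → ℚ_[5][X])) hy
    have hS : ∀ j : Fin n, e ≤ j → y j = 0 := fun j hj => by
      have h : y ⟨e + (j - e), by have := j.2; lia⟩ = 0 :=
        congrFun (congrArg Prod.snd hy) ⟨j - e, by have := j.2; lia⟩
      rwa [show (⟨e + (j - e), by have := j.2; lia⟩ : Fin n) = j from
        Fin.ext (by simp only; lia)] at h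
    rw [LinearMap.mem_ker, Matrix.mulVecLin_apply]
    ext i
    have hi := i.2
    -- A nonzero coefficient would need `k - 2 - (4i + a) = 4j + a` with `j < e`, that is `i + j =
    -- (k + 2 - a)/4 - 1`; but `i + j ≤ n + e - 2`.
    have h0 := coeff_classicalU5_of_trace_eq_zero hk (hF y) hT (i := 4 * i + a) (by lia) (by
      rw [Fintype.linearCombination_apply, Finset.sum_apply, finsetSum_coeff]
      refine Finset.sum_eq_zero fun j _ => ?_
      rw [Pi.smul_apply, coeff_smul, hψ1, coeff_X_pow]
      by_cases hj : e ≤ j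
      · rw [hS j hj, zero_smul]
      · rw [if_neg (by lia), smul_zero])
    rw [Pi.zero_apply, ← h0, Fintype.linearCombination_apply, map_sum, Finset.sum_apply,
      finsetSum_coeff]
    change ∑ j : Fin n, P (4 * (i : ℕ) + a) (4 * (j : ℕ) + a) * y j = _
    refine Finset.sum_congr rfl fun j _ => ?_
    rw [map_smul, Pi.smul_apply, coeff_smul, ← isU5Matrix_apply hP (hψ j).1 (hψ1 j), smul_eq_mul,
      mul_comm]
  -- Rank–nullity: the kernel of `T.prod S` has dimension at least `n - (dUnr + (n - e)) = e -
  -- dUnr`.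
  have h1 := Submodule.finrank_mono hker
  have h2 := LinearMap.finrank_range_add_finrank_ker (T.prod S)
  have h3 := Submodule.finrank_le (LinearMap.range (T.prod S))
  rw [Module.finrank_prod, Module.finrank_fin_fun] at h3
  rw [Module.finrank_fin_fun] at h2
  change _ ≤ corank (minor P a n) at h1
  change _ ≤ dUnr k a + _ at h3
  lia

end HeckeFive

theorem mainTheorem1 (k₀ k a : ℕ)
    (hka : ((a = 0 ∨ a = 2) ∧ k = 4 * k₀ + 2) ∨ ((a = 1 ∨ a = 3) ∧ k = 4 * k₀)) :
    (∃! P : ℕ → ℕ → ℚ_[5], HeckeFive.IsU5Matrix (k : ℤ) P) ∧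
      ∀ P : ℕ → ℕ → ℚ_[5], HeckeFive.IsU5Matrix (k : ℤ) P →
        ∀ n : ℕ, (HeckeFive.dUnr k a : ℤ) < n →
          (n : ℤ) < (HeckeFive.dIw k a : ℤ) - (HeckeFive.dUnr k a : ℤ) →
          min ((n : ℤ) - HeckeFive.dUnr k a)
              ((HeckeFive.dIw k a : ℤ) - HeckeFive.dUnr k a - n)
            ≤ (HeckeFive.corank (HeckeFive.minor P a n) : ℤ) := by
  refine ⟨HeckeFive.existsUnique_isU5Matrix k, fun P hP n h₁ h₂ => ?_⟩
  have hk : HeckeFive.Admissible k a := by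
    rw [HeckeFive.Admissible]
    lia
  have ha : a < 4 := by lia
  have hd := HeckeFive.dIw_le hk ha
  -- This `e` satisfies `n + e ≤ dIw`, which is at most the number of available degrees, and `e -
  -- dUnr` is the asserted minimum.
  have := HeckeFive.le_corank hk ha hP (n := n) (e := min n (HeckeFive.dIw k a - n))
    (min_le_left _ _) (by lia)
  lia
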